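/- **Setting.** Let $\mathbb R^4_1$ be $\mathbb R^4$ with the Lorentzian product $\langle v,w\rangle=-(v^1w^4+v^4w^1)+v^2w^2+v^3w^3$, let $(g_{ij})$ be its matrix in the standard basis $\epsilon_1,\dots,\epsilon_4$, and let $\mathcal L^3_+=\{v:\langle v,v\rangle=0,\ \langle v,\epsilon_1+\epsilon_4\rangle<0\}$. Identify a contact element $(p,n)\in\mathbb R^3\times S^2$ with the isotropic line $[x(p),v(n)]=\{x(p)+t\,v(n):t\in\mathbb R\}$ in $\mathbb R^4_1$, where $$x(p)=\Big(\tfrac{p^1}{\sqrt2},p^2,p^3,-\tfrac{p^1}{\sqrt2}\Big),\qquad v(n)=\Big(\tfrac{1+n^1}{2},\tfrac{n^2}{\sqrt2},\tfrac{n^3}{\sqrt2},\tfrac{1-n^1}{2}\Big);$$ let $\Lambda$ be the space of these lines. Let $M$ be a connected smooth surface. A *Legendre immersion* $F=(f,n):M\to\Lambda$ is a pair of smooth maps $f:M\to\mathbb R^3$, $n:M\to S^2$ with $df\cdot n=0$ and $dn\cdot dn$ positive definite; it is *nondegenerate* if the quadratic forms $df\cdot dn$ and $dn\cdot dn$ are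 linearly independent at every point. A *middle frame field* along $F$ on an open set $U\subset M$ consists of smooth maps $a_0,a_1,\dots,a_4:U\to\mathbb R^4_1$ with $\langle a_i,a_j\rangle=g_{ij}$ for $1\le i,j\le4$, $\det(a_1,\dots,a_4)=1$, $a_1,a_4\in\mathcal L^3_+$ and $[a_0,a_1]=F$, for which there are smooth functions $p_1,p_2,p_3,q_1,q_2$ and 1-forms $\alpha^2,\alpha^3$ on $U$ such that $$\begin{aligned}da_0&=\alpha^2a_2+\alpha^3a_3,\\ da_1&=2(q_2\alpha^2-q_1\alpha^3)a_1+\alpha^2a_2-\alpha^3a_3,\\ da_2&=(p_1\alpha^2+p_2\alpha^3)a_1+(q_1\alpha^2+q_2\alpha^3)a_3+\alpha^2a_4,\\ da_3&=(p_2\alpha^2+p_3\alpha^3)a_1-(q_1\alpha^2+q_2\alpha^3)a_2-\alpha^3a_4,\\ da_4&=(p_1\alpha^2+p_2\alpha^3)a_2+(p_2\alpha^2+p_3\alpha^3)a_3-2(q_2\alpha^2-q_1\alpha^3)a_4.\end{aligned}$$ For nondegenerate $F$, such a frame exists near every point and is unique up to $(a_2,a_3)\mapsto(-a_2,-a_3)$.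 Orient $M$ so that $\alpha^2\wedge\alpha^3>0$, and regard $M$ as the Riemann surface for which $\varphi=\alpha^2+i\alpha^3$ is of type $(1,0)$. The following are then globally defined: the *L-Gauss map* $\sigma_F=a_0:M\to\mathbb R^4_1$, and the differentials $$\mathcal Q_F=\big(\tfrac12(p_1-p_3)-ip_2\big)\varphi^4,\qquad \mathcal P_F=(p_1+p_3)\varphi^2 .$$ The immersion $F$ is *L-isothermic* if near every point there are local coordinates $(x,y)$ of $M$ that diagonalize both quadratic forms $\langle da_0,da_0\rangle$ and $\langle da_0,da_1\rangle$ and are isothermal for $\langle da_0,da_0\rangle$. **Proposition 4.4.** Let $F:M\to\Lambda$ be a nondegenerate Legendre immersion of a connected smooth surface. The following two statements are equivalent: 1. $\mathcal Q_F$ is holomorphic and $\mathcal P_F$ is non-zero (that is, not identically zero on $M$). 2. $F$ is L-isothermic, and there are a point $O\in\mathbb R^4_1$ and a constant $c\in\mathbb R$ such that $\langle\sigma_F(p)-O,\sigma_F(p)-O\rangle=c$ for all $p\in M$. -/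

import Mathlib

open scoped Manifold ContDiff

noncomputable section

namespace Laguerre

/-! ### Minkowski 4-space and the cyclographic model -/

/-- The vector space underlying Minkowski 4-space `ℝ⁴₁`; the components `v¹, …, v⁴` of a vector
are `v 0, …, v 3`. -/
abbrev Mink : Type := Fin 4 → ℝ

/-- The Lorentzian scalar product `⟨v, w⟩ = -(v¹w⁴ + v⁴w¹) + v²w² + v³w³`. -/
def lor (v w : Mink) : ℝ :=
  -(v 0 * w 3 + v 3 * w 0) + v 1 * w 1 + v 2 * w 2

/-- The standard basis vector `ε i`. -/
def stdVec (i : Fin 4) : Mink := Pi.single i 1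

/-- The positive light cone: `⟨v, v⟩ = 0` and `⟨v, ε₁ + ε₄⟩ < 0`. -/
def posLightCone : Set Mink :=
  {v | lor v v = 0 ∧ lor v (stdVec 0 + stdVec 3) < 0}

/-- The matrix whose columns are the four given vectors. -/
def colMatrix (a : Fin 4 → Mink) : Matrix (Fin 4) (Fin 4) ℝ :=
  Matrix.of fun i j => a j i

/-- The linear part `(a₁, …, a₄)` of a Laguerre frame, i.e. of an element of the Laguerre group:
`⟨aᵢ, aⱼ⟩ = ⟨εᵢ, εⱼ⟩`, `det a = 1`, and `a₁`, `a₄` lie in the positive light cone. -/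
structure IsLaguerreBasis (a : Fin 4 → Mink) : Prop where
  gram : ∀ i j, lor (a i) (a j) = lor (stdVec i) (stdVec j)
  det_eq_one : (colMatrix a).det = 1
  fst_mem : a 0 ∈ posLightCone
  last_mem : a 3 ∈ posLightCone

/-- The line `[x, v] = {x + t v}`; the Laguerre space consists of the lines with `v` in the
positive light cone. -/
def isotropicLine (x v : Mink) : Set Mink := {y | ∃ t : ℝ, y = x + t • v}

/-- The point of `ℝ⁴₁` that represents the oriented sphere with center `p` and signed radius
`r`. -/
def spherePoint (p : EuclideanSpace ℝ (Fin 3)) (r : ℝ) : Mink :=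
  ![(r + p 0) / √2, p 1, p 2, (r - p 0) / √2]

/-- The isotropic normal vector that represents an oriented plane with unit normal `n`. -/
def planeVec (n : EuclideanSpace ℝ (Fin 3)) : Mink :=
  ![(1 + n 0) / 2, n 1 / √2, n 2 / √2, (1 - n 0) / 2]

/-! ### Legendre immersions -/

section

variable {M : Type*} [TopologicalSpace M] [ChartedSpace (EuclideanSpace ℝ (Fin 2)) M]

/-- The differential at `p` of a map from the surface `M` to a vector space. -/
def diff {E : Type*} [NormedAddCommGroup E] [NormedSpace ℝ E] (g : M → E) (p : M) :
    TangentSpace (𝓡 2) p →L[ℝ] E :=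
  mfderiv (𝓡 2) 𝓘(ℝ, E) g p

variable (M) in
/-- A smooth Legendre immersion `F = (f, n) : M → ℝ³ × S²` into the space of contact elements:
`df · n = 0`, and `dn · dn` is positive definite (in particular `F` is an immersion). -/
structure LegendreImmersion where
  f : M → EuclideanSpace ℝ (Fin 3)
  n : M → EuclideanSpace ℝ (Fin 3)
  smooth_f : ContMDiff (𝓡 2) 𝓘(ℝ, EuclideanSpace ℝ (Fin 3)) ∞ f
  smooth_n : ContMDiff (𝓡 2) 𝓘(ℝ, EuclideanSpace ℝ (Fin 3)) ∞ n
  norm_n : ∀ p, ‖n p‖ = 1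
  legendre : ∀ p (X : TangentSpace (𝓡 2) p), inner ℝ (diff f p X) (n p) = 0
  third_pos : ∀ p (X : TangentSpace (𝓡 2) p), X ≠ 0 → 0 < inner ℝ (diff n p X) (diff n p X)

namespace LegendreImmersion

/-- `F` as a map into the Laguerre space: the isotropic line that corresponds to the contact
element `(f p, n p)`. -/
def line (F : LegendreImmersion M) (p : M) : Set Mink :=
  isotropicLine (spherePoint (F.f p) 0) (planeVec (F.n p))

/-- `F` is nondegenerate: the quadratic forms `df · dn` and `dn · dn` are linearly independent at
every point. -/
def IsNondegenerate (F : LegendreImmersion M) : Prop :=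
  ∀ p : M, LinearIndependent ℝ
    ![fun X : TangentSpace (𝓡 2) p => (inner ℝ (diff F.f p X) (diff F.n p X) : ℝ),
      fun X : TangentSpace (𝓡 2) p => (inner ℝ (diff F.n p X) (diff F.n p X) : ℝ)]

end LegendreImmersion

/-! ### Frame fields -/

/-- A Laguerre frame field `A = (a₀, a)` along `F` on the open set `domain`: a smooth map into the
Laguerre group with `[a₀, a₁] = F`. The vectors `a₁, …, a₄` are `a 0, …, a 3`. The values outside
`domain` are irrelevant. -/
structure FrameField (F : LegendreImmersion M) where
  domain : Set M
  isOpen_domain : IsOpen domain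
  a₀ : M → Mink
  a : Fin 4 → M → Mink
  smooth_a₀ : ContMDiffOn (𝓡 2) 𝓘(ℝ, Mink) ∞ a₀ domain
  smooth_a : ∀ i, ContMDiffOn (𝓡 2) 𝓘(ℝ, Mink) ∞ (a i) domain
  isBasis : ∀ p ∈ domain, IsLaguerreBasis fun i => a i p
  line_eq : ∀ p ∈ domain, isotropicLine (a₀ p) (a 0 p) = F.line p

namespace FrameField

variable {F : LegendreImmersion M}

/-- The translational part `(α₀ⁱ)` of `A⁻¹ dA`, so that `da₀ = ∑ᵢ α₀ⁱ aᵢ`. -/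
def form₀ (A : FrameField F) (p : M) (X : TangentSpace (𝓡 2) p) : Fin 4 → ℝ :=
  (colMatrix fun i => A.a i p)⁻¹.mulVec (diff A.a₀ p X)

/-- The linear part `(αⱼⁱ)` of `A⁻¹ dA` (row `i`, column `j`), so that `daⱼ = ∑ᵢ αⱼⁱ aᵢ`. -/
def form (A : FrameField F) (p : M) (X : TangentSpace (𝓡 2) p) : Matrix (Fin 4) (Fin 4) ℝ :=
  (colMatrix fun i => A.a i p)⁻¹ * colMatrix fun i => diff (A.a i) p X

/-- The 1-form `α₀²`. -/
def θ₂ (A : FrameField F) (p : M) (X : TangentSpace (𝓡 2) p) : ℝ := A.form₀ p X 1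

/-- The 1-form `α₀³`. -/
def θ₃ (A : FrameField F) (p : M) (X : TangentSpace (𝓡 2) p) : ℝ := A.form₀ p X 2

/-- The complex 1-form `φ = α₀² + i α₀³`. -/
def φ (A : FrameField F) (p : M) (X : TangentSpace (𝓡 2) p) : ℂ :=
  (A.θ₂ p X : ℂ) + Complex.I * (A.θ₃ p X : ℂ)

end FrameField

/-- A middle frame field along `F`, with its invariants. The forms `α₀²`, `α₀³` are automatically
linearly independent on the domain, because `dn · dn` is positive definite; `M` is given the
orientation for which `α₀² ∧ α₀³ > 0`. -/
structure MiddleFrameField (F : LegendreImmersion M) extends FrameField F where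
  p₁ : M → ℝ
  p₂ : M → ℝ
  p₃ : M → ℝ
  q₁ : M → ℝ
  q₂ : M → ℝ
  smooth_p₁ : ContMDiffOn (𝓡 2) 𝓘(ℝ, ℝ) ∞ p₁ domain
  smooth_p₂ : ContMDiffOn (𝓡 2) 𝓘(ℝ, ℝ) ∞ p₂ domain
  smooth_p₃ : ContMDiffOn (𝓡 2) 𝓘(ℝ, ℝ) ∞ p₃ domain
  smooth_q₁ : ContMDiffOn (𝓡 2) 𝓘(ℝ, ℝ) ∞ q₁ domain
  smooth_q₂ : ContMDiffOn (𝓡 2) 𝓘(ℝ, ℝ) ∞ q₂ domain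
  form₀_eq : ∀ p ∈ domain, ∀ X : TangentSpace (𝓡 2) p,
    toFrameField.form₀ p X = ![0, toFrameField.θ₂ p X, toFrameField.θ₃ p X, 0]
  form_eq : ∀ p ∈ domain, ∀ X : TangentSpace (𝓡 2) p,
    let α := toFrameField.θ₂ p X
    let β := toFrameField.θ₃ p X
    toFrameField.form p X =
      !![2 * q₂ p * α - 2 * q₁ p * β, p₁ p * α + p₂ p * β, p₂ p * α + p₃ p * β, 0;
         α, 0, -(q₁ p * α) - q₂ p * β, p₁ p * α + p₂ p * β;
         -β, q₁ p * α + q₂ p * β, 0, p₂ p * α + p₃ p * β;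
         0, α, -β, -(2 * q₂ p * α) + 2 * q₁ p * β]

/-- There is the middle frame field with empty domain. -/
instance (F : LegendreImmersion M) : Nonempty (MiddleFrameField F) :=
  ⟨{ domain := ∅
     isOpen_domain := isOpen_empty
     a₀ := 0
     a := 0
     smooth_a₀ := fun _ h => h.elim
     smooth_a := fun _ _ h => h.elim
     isBasis := fun _ h => h.elim
     line_eq := fun _ h => h.elim
     p₁ := 0
     p₂ := 0
     p₃ := 0
     q₁ := 0
     q₂ := 0
     smooth_p₁ := fun _ h => h.elim
     smooth_p₂ := fun _ h => h.elim
     smooth_p₃ := fun _ h => h.elim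
     smooth_q₁ := fun _ h => h.elim
     smooth_q₂ := fun _ h => h.elim
     form₀_eq := fun _ h => h.elim
     form_eq := fun _ h => h.elim }⟩

namespace LegendreImmersion

/-- A middle frame field defined near `p`. If `F` is nondegenerate there is one, and it is unique
near `p` up to `(a₂, a₃) ↦ (-a₂, -a₃)`. -/
def middleFrameAt (F : LegendreImmersion M) (p : M) : MiddleFrameField F :=
  Classical.epsilon fun A : MiddleFrameField F => p ∈ A.domain

/-- The L-Gauss map `σ_F = a₀`. -/
def lGaussMap (F : LegendreImmersion M) (p : M) : Mink :=
  (F.middleFrameAt p).a₀ p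

/-- The quartic differential `𝒬_F = Q φ⁴`, `Q = (p₁ - p₃) / 2 - i p₂`, as a function on tangent
vectors. -/
def quarticDifferential (F : LegendreImmersion M) (p : M) (X : TangentSpace (𝓡 2) p) : ℂ :=
  let A := F.middleFrameAt p
  (((A.p₁ p - A.p₃ p) / 2 : ℝ) - Complex.I * (A.p₂ p : ℂ)) * A.φ p X ^ 4

/-- The quadratic differential `𝒫_F = P φ²`, `P = p₁ + p₃`, as a function on tangent vectors. -/
def quadraticDifferential (F : LegendreImmersion M) (p : M) (X : TangentSpace (𝓡 2) p) : ℂ :=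
  let A := F.middleFrameAt p
  ((A.p₁ p + A.p₃ p : ℝ) : ℂ) * A.φ p X ^ 2

end LegendreImmersion

/-! ### Coordinates, holomorphic quartic differentials, L-isothermic immersions -/

/-- `z = x + i y` is a smooth local coordinate system on the open set `z.source`. -/
def IsSmoothCoordinate (z : OpenPartialHomeomorph M ℂ) : Prop :=
  ContMDiffOn (𝓡 2) 𝓘(ℝ, ℂ) ∞ z z.source ∧ ContMDiffOn 𝓘(ℝ, ℂ) (𝓡 2) ∞ z.symm z.target

namespace LegendreImmersion

/-- `z` is a local complex coordinate for the complex structure on `M` for which the forms `φ` of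
middle frame fields are of type `(1, 0)`, i.e. multiples of `dz`. -/
def IsComplexCoordinate (F : LegendreImmersion M) (z : OpenPartialHomeomorph M ℂ) : Prop :=
  IsSmoothCoordinate z ∧ ∀ p ∈ z.source, ∃ A : MiddleFrameField F, p ∈ A.domain ∧
    ∀ q ∈ A.domain ∩ z.source, ∃ c : ℂ, ∀ X : TangentSpace (𝓡 2) q,
      A.φ q X = c * diff (z : M → ℂ) q X

/-- `𝒬_F` is holomorphic: near every point, `𝒬_F = h(z) dz⁴` for a local complex coordinate `z` and
a holomorphic function `h`. -/
def HasHolomorphicQuartic (F : LegendreImmersion M) : Prop :=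
  ∀ p : M, ∃ z : OpenPartialHomeomorph M ℂ, F.IsComplexCoordinate z ∧ p ∈ z.source ∧
    ∃ h : ℂ → ℂ, DifferentiableOn ℂ h z.target ∧
      ∀ q ∈ z.source, ∀ X : TangentSpace (𝓡 2) q,
        F.quarticDifferential q X = h (z q) * diff (z : M → ℂ) q X ^ 4

/-- `F` is L-isothermic: near every point there are coordinates `z = x + i y` that diagonalize
both `⟨da₀, da₀⟩` and `⟨da₀, da₁⟩`, where `A = (a₀, a)` is a middle frame field, and that are
isothermal for `⟨da₀, da₀⟩`. -/
def IsLIsothermic (F : LegendreImmersion M) : Prop :=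
  ∀ p : M, ∃ z : OpenPartialHomeomorph M ℂ, IsSmoothCoordinate z ∧ p ∈ z.source ∧
    ∃ A : MiddleFrameField F, z.source ⊆ A.domain ∧
      ∀ q ∈ z.source, ∃ E a b : ℝ, 0 < E ∧ ∀ X : TangentSpace (𝓡 2) q,
        lor (diff A.a₀ q X) (diff A.a₀ q X) =
          E * ((diff (z : M → ℂ) q X).re ^ 2 + (diff (z : M → ℂ) q X).im ^ 2) ∧
        lor (diff A.a₀ q X) (diff (A.a 0) q X) =
          a * (diff (z : M → ℂ) q X).re ^ 2 + b * (diff (z : M → ℂ) q X).im ^ 2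

end LegendreImmersion

end

end Laguerre

end

/-!
Write `τ = 2 (q₂ α² - q₁ α³)` and `s = (p₁ + p₃) / 2`, `d = (p₁ - p₃) / 2`.

*Reduction to one frame.* Both sides of the equivalence provide middle frames near every point, so
only their uniqueness is needed: two middle frames agree up to the sign of `(a₂, a₃)`
(`MiddleFrameField.a₀_eq_and_a_zero_eq`, `MiddleFrameField.exists_sign`). Hence `σ_F`, `𝒬_F`,
`𝒫_F` can be computed from any middle frame. In a coordinate `z` with `φ = μ dz` a middle frame
becomes a `ConformalFrame` on an open subset of `ℂ`; symmetry of the second derivatives gives the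
structure equations, in particular `dτ = 2 p₂ α² ∧ α³` (`ConformalFrame.structure_τ`) and the
Codazzi equations (`ConformalFrame.codazzi₁`, `ConformalFrame.codazzi₂`).

*Holomorphic quartic differential.* Combined with the Codazzi equations, holomorphy of `𝒬_F` is
the equation `ds = -s τ` (`ConformalFrame.fderiv_s_of_holomorphic`). It shows that `s` vanishes
everywhere or nowhere on the connected surface, and its integrability condition `s dτ = 0` gives
`p₂ = 0`. The Codazzi equations then give `dd = -2 d τ`. From these one checks that
`O = a₀ + (d / s) a₁ - (1 / s) a₄` is constant (`ConformalFrame.fderiv_center_eq_zero`), and so is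
`⟨a₀ - O, a₀ - O⟩`. Moreover `|s|^{1/2} φ = g dz` with `g` holomorphic
(`ConformalFrame.differentiableAt_exp_mul_μ`), and a primitive of `g` is an isothermic coordinate.

*Spherical L-Gauss map.* Differentiating `⟨a₀ - O, a₀ - O⟩ = c` shows `a₀ - O = u a₁ + v a₄`.
Differentiating this in turn gives `p₂ = 0`, `v s = 1`, `v d = -u`, `du = -u τ`, `dv = v τ`; so
`s` is nowhere zero, and `dd = -2 d τ`. An isothermic coordinate can be adjusted by a linear map of
`ℂ` such that `φ = r dz` with `r` real (`LegendreImmersion.IsLIsothermic.exists_real_factor`); then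
`dr = r τ / 2`, and `𝒬_F = d r⁴ dz⁴` has a locally constant coefficient
(`ConformalFrame.quartic_of_lor_sub_eq_const`).
-/

noncomputable section

namespace Laguerre

open Filter Topology

/-! ### The Lorentzian product and Laguerre bases -/

lemma lor_comm (v w : Mink) : lor v w = lor w v := by simp only [lor]; ring

lemma lor_add_left (u v w : Mink) : lor (u + v) w = lor u w + lor v w := by
  simp only [lor, Pi.add_apply]; ring

lemma lor_sub_left (u v w : Mink) : lor (u - v) w = lor u w - lor v w := by
  simp only [lor, Pi.sub_apply]; ring

lemma lor_smul_left (c : ℝ) (v w : Mink) : lor (c • v) w = c * lor v w := by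
  simp only [lor, Pi.smul_apply, smul_eq_mul]; ring

lemma lor_add_right (u v w : Mink) : lor u (v + w) = lor u v + lor u w := by
  simp only [lor, Pi.add_apply]; ring

lemma lor_sub_right (u v w : Mink) : lor u (v - w) = lor u v - lor u w := by
  simp only [lor, Pi.sub_apply]; ring

lemma lor_smul_right (c : ℝ) (v w : Mink) : lor v (c • w) = c * lor v w := by
  simp only [lor, Pi.smul_apply, smul_eq_mul]; ring

/-- The Lorentzian product as a continuous bilinear map. -/
def lorL : Mink →L[ℝ] Mink →L[ℝ] ℝ :=
  (LinearMap.mk₂ ℝ lor lor_add_left lor_smul_left lor_add_right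
    lor_smul_right).toContinuousBilinearMap

/-- `(e₁, e₂, e₃, e₄)` is a basis with the scalar products of the standard basis of `ℝ⁴₁`; all
sixteen products are listed, and `expand` gives the coordinates of a vector. -/
structure IsNullBasis (e₁ e₂ e₃ e₄ : Mink) : Prop where
  e11 : lor e₁ e₁ = 0
  e12 : lor e₁ e₂ = 0
  e13 : lor e₁ e₃ = 0
  e14 : lor e₁ e₄ = -1
  e21 : lor e₂ e₁ = 0
  e22 : lor e₂ e₂ = 1
  e23 : lor e₂ e₃ = 0
  e24 : lor e₂ e₄ = 0
  e31 : lor e₃ e₁ = 0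
  e32 : lor e₃ e₂ = 0
  e33 : lor e₃ e₃ = 1
  e34 : lor e₃ e₄ = 0
  e41 : lor e₄ e₁ = -1
  e42 : lor e₄ e₂ = 0
  e43 : lor e₄ e₃ = 0
  e44 : lor e₄ e₄ = 0
  expand (w : Mink) : w = -lor w e₄ • e₁ + lor w e₂ • e₂ + lor w e₃ • e₃ + -lor w e₁ • e₄

lemma colMatrix_mulVec (a : Fin 4 → Mink) (c : Fin 4 → ℝ) :
    (colMatrix a).mulVec c = c 0 • a 0 + c 1 • a 1 + c 2 • a 2 + c 3 • a 3 := by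
  ext i
  simp [colMatrix, Matrix.mulVec, dotProduct, Fin.sum_univ_four, mul_comm]

lemma IsLaguerreBasis.isUnit_det {a : Fin 4 → Mink} (h : IsLaguerreBasis a) :
    IsUnit (colMatrix a).det := by
  rw [h.det_eq_one]; exact isUnit_one

lemma IsLaguerreBasis.isNullBasis {a : Fin 4 → Mink} (h : IsLaguerreBasis a) :
    IsNullBasis (a 0) (a 1) (a 2) (a 3) := by
  have e11 : lor (a 0) (a 0) = 0 := by rw [h.gram]; simp [lor, stdVec]
  have e12 : lor (a 0) (a 1) = 0 := by rw [h.gram]; simp [lor, stdVec]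
  have e13 : lor (a 0) (a 2) = 0 := by rw [h.gram]; simp [lor, stdVec]
  have e14 : lor (a 0) (a 3) = -1 := by rw [h.gram]; simp [lor, stdVec]
  have e22 : lor (a 1) (a 1) = 1 := by rw [h.gram]; simp [lor, stdVec]
  have e23 : lor (a 1) (a 2) = 0 := by rw [h.gram]; simp [lor, stdVec]
  have e24 : lor (a 1) (a 3) = 0 := by rw [h.gram]; simp [lor, stdVec]
  have e33 : lor (a 2) (a 2) = 1 := by rw [h.gram]; simp [lor, stdVec]
  have e34 : lor (a 2) (a 3) = 0 := by rw [h.gram]; simp [lor, stdVec]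
  have e44 : lor (a 3) (a 3) = 0 := by rw [h.gram]; simp [lor, stdVec]
  have e21 : lor (a 1) (a 0) = 0 := by rw [lor_comm, e12]
  have e31 : lor (a 2) (a 0) = 0 := by rw [lor_comm, e13]
  have e41 : lor (a 3) (a 0) = -1 := by rw [lor_comm, e14]
  have e32 : lor (a 2) (a 1) = 0 := by rw [lor_comm, e23]
  have e42 : lor (a 3) (a 1) = 0 := by rw [lor_comm, e24]
  have e43 : lor (a 3) (a 2) = 0 := by rw [lor_comm, e34]
  refine ⟨e11, e12, e13, e14, e21, e22, e23, e24, e31, e32, e33, e34, e41, e42, e43, e44,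
    fun w => ?_⟩
  set c := (colMatrix a)⁻¹.mulVec w
  have hw : w = c 0 • a 0 + c 1 • a 1 + c 2 • a 2 + c 3 • a 3 := by
    rw [← colMatrix_mulVec, Matrix.mulVec_mulVec, Matrix.mul_nonsing_inv _ h.isUnit_det,
      Matrix.one_mulVec]
  have hj (x : Mink) : lor w x = c 0 * lor (a 0) x + c 1 * lor (a 1) x + c 2 * lor (a 2) x +
      c 3 * lor (a 3) x := by
    conv_lhs => rw [hw]
    simp only [lor_add_left, lor_smul_left]
  have h0 : c 0 = -lor w (a 3) := by rw [hj, e14, e24, e34, e44]; ring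
  have h1 : c 1 = lor w (a 1) := by rw [hj, e12, e22, e32, e42]; ring
  have h2 : c 2 = lor w (a 2) := by rw [hj, e13, e23, e33, e43]; ring
  have h3 : c 3 = -lor w (a 0) := by rw [hj, e11, e21, e31, e41]; ring
  rw [← h0, ← h1, ← h2, ← h3]
  exact hw

/-- On the hyperplane `e₁^⊥` the Lorentzian product is the degenerate form given by the
`e₂`- and `e₃`-coordinates. -/
lemma IsNullBasis.lor_eq_of_orthogonal {e₁ e₂ e₃ e₄ : Mink} (h : IsNullBasis e₁ e₂ e₃ e₄)
    {v w : Mink} (hv : lor v e₁ = 0) (hw : lor w e₁ = 0) :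
    lor v w = lor v e₂ * lor w e₂ + lor v e₃ * lor w e₃ := by
  conv_lhs => rw [h.expand v]
  simp only [lor_add_left, lor_smul_left]
  rw [hv, lor_comm e₁ w, hw, lor_comm e₂, lor_comm e₃]
  ring

/-! ### Differentials of maps into Minkowski space -/

section

variable {M : Type*} [TopologicalSpace M] [ChartedSpace (EuclideanSpace ℝ (Fin 2)) M]

lemma diff_congr {E : Type*} [NormedAddCommGroup E] [NormedSpace ℝ E] {f g : M → E} {p : M}
    (h : f =ᶠ[𝓝 p] g) (X : TangentSpace (𝓡 2) p) : diff f p X = diff g p X := by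
  have := h.mfderiv_eq (I := 𝓡 2) (I' := 𝓘(ℝ, E))
  unfold diff
  rw [this]

lemma diff_const {E : Type*} [NormedAddCommGroup E] [NormedSpace ℝ E] (c : E) {p : M}
    (X : TangentSpace (𝓡 2) p) : diff (fun _ : M => c) p X = 0 := by
  have : mfderiv (𝓡 2) 𝓘(ℝ, E) (fun _ : M => c) p = 0 := mfderiv_const
  unfold diff
  rw [this]; rfl

lemma diff_sub {E : Type*} [NormedAddCommGroup E] [NormedSpace ℝ E] {f g : M → E} {p : M}
    (hf : MDifferentiableAt (𝓡 2) 𝓘(ℝ, E) f p) (hg : MDifferentiableAt (𝓡 2) 𝓘(ℝ, E) g p)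
    (X : TangentSpace (𝓡 2) p) :
    diff (fun q => f q - g q) p X = diff f p X - diff g p X := by
  have := (hf.hasMFDerivAt.sub hg.hasMFDerivAt).mfderiv
  unfold diff
  exact congrArg (fun L => L X) this

lemma diff_lor {f g : M → Mink} {p : M} (hf : MDifferentiableAt (𝓡 2) 𝓘(ℝ, Mink) f p)
    (hg : MDifferentiableAt (𝓡 2) 𝓘(ℝ, Mink) g p) (X : TangentSpace (𝓡 2) p) :
    diff (fun q => lor (f q) (g q)) p X = lor (diff f p X) (g p) + lor (f p) (diff g p X) := by
  have hB : HasMFDerivAt 𝓘(ℝ, Mink × Mink) 𝓘(ℝ, ℝ) (fun x : Mink × Mink => lorL x.1 x.2)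
      (f p, g p) _ := (lorL.isBoundedBilinearMap.hasFDerivAt (f p, g p)).hasMFDerivAt
  have hfg : HasMFDerivAt (𝓡 2) 𝓘(ℝ, Mink × Mink) (fun q => (f q, g q)) p
      ((mfderiv (𝓡 2) 𝓘(ℝ, Mink) f p).prod (mfderiv (𝓡 2) 𝓘(ℝ, Mink) g p)) :=
    ⟨hf.hasMFDerivAt.1.prodMk hg.hasMFDerivAt.1, hf.hasMFDerivAt.2.prodMk hg.hasMFDerivAt.2⟩
  have := (HasMFDerivAt.comp p hB hfg).mfderiv
  unfold diff
  refine (congrArg (fun L => L X) this).trans ?_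
  rw [add_comm]
  rfl

/-- The Leibniz rule for a locally constant scalar product. -/
lemma lor_diff_add_of_eventually {f g : M → Mink} {p : M}
    (hf : MDifferentiableAt (𝓡 2) 𝓘(ℝ, Mink) f p) (hg : MDifferentiableAt (𝓡 2) 𝓘(ℝ, Mink) g p)
    {c : ℝ} (h : ∀ᶠ q in 𝓝 p, lor (f q) (g q) = c) (X : TangentSpace (𝓡 2) p) :
    lor (diff f p X) (g p) + lor (f p) (diff g p X) = 0 := by
  rw [← diff_lor hf hg, diff_congr (g := fun _ => c) h, diff_const]

/-! ### The structure equations of a middle frame -/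

variable {F : LegendreImmersion M}

namespace FrameField

lemma domain_mem_nhds (A : FrameField F) {p : M} (hp : p ∈ A.domain) : A.domain ∈ 𝓝 p :=
  A.isOpen_domain.mem_nhds hp

lemma mdiff_a₀ (A : FrameField F) {p : M} (hp : p ∈ A.domain) :
    MDifferentiableAt (𝓡 2) 𝓘(ℝ, Mink) A.a₀ p :=
  (A.smooth_a₀.contMDiffAt (A.domain_mem_nhds hp)).mdifferentiableAt (by simp)

lemma mdiff_a (A : FrameField F) {p : M} (hp : p ∈ A.domain) (i : Fin 4) :
    MDifferentiableAt (𝓡 2) 𝓘(ℝ, Mink) (A.a i) p :=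
  ((A.smooth_a i).contMDiffAt (A.domain_mem_nhds hp)).mdifferentiableAt (by simp)

lemma isNullBasis (A : FrameField F) {p : M} (hp : p ∈ A.domain) :
    IsNullBasis (A.a 0 p) (A.a 1 p) (A.a 2 p) (A.a 3 p) := (A.isBasis p hp).isNullBasis

lemma diff_a_eq_sum (A : FrameField F) {p : M} (hp : p ∈ A.domain) (X : TangentSpace (𝓡 2) p)
    (j : Fin 4) : diff (A.a j) p X = A.form p X 0 j • A.a 0 p + A.form p X 1 j • A.a 1 p +
      A.form p X 2 j • A.a 2 p + A.form p X 3 j • A.a 3 p := by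
  have h1 : colMatrix (fun i => A.a i p) * A.form p X = colMatrix fun i => diff (A.a i) p X := by
    rw [form, ← mul_assoc, Matrix.mul_nonsing_inv _ (A.isBasis p hp).isUnit_det, one_mul]
  ext i
  have h2 := congrFun (congrFun h1 i) j
  simp only [Matrix.mul_apply, Fin.sum_univ_four, colMatrix, Matrix.of_apply] at h2
  simp only [Pi.add_apply, Pi.smul_apply, smul_eq_mul]
  rw [← h2]
  ring

lemma diff_a₀_eq_sum (A : FrameField F) {p : M} (hp : p ∈ A.domain)
    (X : TangentSpace (𝓡 2) p) : diff A.a₀ p X = A.form₀ p X 0 • A.a 0 p +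
      A.form₀ p X 1 • A.a 1 p + A.form₀ p X 2 • A.a 2 p + A.form₀ p X 3 • A.a 3 p := by
  rw [← colMatrix_mulVec (fun i => A.a i p), form₀, Matrix.mulVec_mulVec,
    Matrix.mul_nonsing_inv _ (A.isBasis p hp).isUnit_det, Matrix.one_mulVec]

end FrameField

namespace MiddleFrameField

variable (A : MiddleFrameField F) {p : M} (X : TangentSpace (𝓡 2) p)

/-- The 1-form `τ = 2 (q₂ α² - q₁ α³)`, the `a₁`-component of `da₁`. -/
def τ (A : MiddleFrameField F) (p : M) (X : TangentSpace (𝓡 2) p) : ℝ :=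
  2 * A.q₂ p * A.θ₂ p X - 2 * A.q₁ p * A.θ₃ p X

lemma diff_a₀ (hp : p ∈ A.domain) :
    diff A.a₀ p X = A.θ₂ p X • A.a 1 p + A.θ₃ p X • A.a 2 p := by
  rw [A.diff_a₀_eq_sum hp, A.form₀_eq p hp]
  simp

lemma diff_a_zero (hp : p ∈ A.domain) : diff (A.a 0) p X =
    A.τ p X • A.a 0 p + A.θ₂ p X • A.a 1 p - A.θ₃ p X • A.a 2 p := by
  rw [A.diff_a_eq_sum hp, A.form_eq p hp]
  simp [τ, sub_eq_add_neg]

lemma diff_a_one (hp : p ∈ A.domain) : diff (A.a 1) p X =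
    (A.p₁ p * A.θ₂ p X + A.p₂ p * A.θ₃ p X) • A.a 0 p +
      (A.q₁ p * A.θ₂ p X + A.q₂ p * A.θ₃ p X) • A.a 2 p + A.θ₂ p X • A.a 3 p := by
  rw [A.diff_a_eq_sum hp, A.form_eq p hp]
  simp

lemma diff_a_two (hp : p ∈ A.domain) : diff (A.a 2) p X =
    (A.p₂ p * A.θ₂ p X + A.p₃ p * A.θ₃ p X) • A.a 0 p -
      (A.q₁ p * A.θ₂ p X + A.q₂ p * A.θ₃ p X) • A.a 1 p - A.θ₃ p X • A.a 3 p := by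
  rw [A.diff_a_eq_sum hp, A.form_eq p hp]
  simp only [Matrix.of_apply, Matrix.cons_val]
  module

lemma diff_a_three (hp : p ∈ A.domain) : diff (A.a 3) p X =
    (A.p₁ p * A.θ₂ p X + A.p₂ p * A.θ₃ p X) • A.a 1 p +
      (A.p₂ p * A.θ₂ p X + A.p₃ p * A.θ₃ p X) • A.a 2 p - A.τ p X • A.a 3 p := by
  rw [A.diff_a_eq_sum hp, A.form_eq p hp]
  simp only [Matrix.of_apply, Matrix.cons_val, τ]
  module

lemma lor_diff_a₀_one (hp : p ∈ A.domain) : lor (diff A.a₀ p X) (A.a 1 p) = A.θ₂ p X := by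
  have e := A.isNullBasis hp
  rw [A.diff_a₀ X hp]
  simp only [lor_add_left, lor_smul_left, e.e22, e.e32]
  ring

lemma lor_diff_a₀_two (hp : p ∈ A.domain) : lor (diff A.a₀ p X) (A.a 2 p) = A.θ₃ p X := by
  have e := A.isNullBasis hp
  rw [A.diff_a₀ X hp]
  simp only [lor_add_left, lor_smul_left, e.e23, e.e33]
  ring

lemma lor_diff_a₀_self (hp : p ∈ A.domain) :
    lor (diff A.a₀ p X) (diff A.a₀ p X) = A.θ₂ p X ^ 2 + A.θ₃ p X ^ 2 := by
  have e := A.isNullBasis hp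
  rw [A.diff_a₀ X hp]
  simp only [lor_add_left, lor_smul_left, lor_add_right, lor_smul_right, e.e23, e.e33, e.e22, e.e32]
  ring

lemma lor_diff_a_zero_self (hp : p ∈ A.domain) :
    lor (diff (A.a 0) p X) (diff (A.a 0) p X) = A.θ₂ p X ^ 2 + A.θ₃ p X ^ 2 := by
  have e := A.isNullBasis hp
  rw [A.diff_a_zero X hp]
  simp only [lor_add_left, lor_smul_left, lor_add_right, lor_smul_right, lor_sub_left,
    lor_sub_right, e.e23, e.e33, e.e22, e.e32, e.e11, e.e12, e.e13, e.e21, e.e31]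
  ring

lemma lor_diff_a₀_diff_a_zero (hp : p ∈ A.domain) :
    lor (diff A.a₀ p X) (diff (A.a 0) p X) = A.θ₂ p X ^ 2 - A.θ₃ p X ^ 2 := by
  have e := A.isNullBasis hp
  rw [A.diff_a₀ X hp, A.diff_a_zero X hp]
  simp only [lor_add_left, lor_smul_left, lor_add_right, lor_smul_right,
    lor_sub_right, e.e23, e.e33, e.e22, e.e32, e.e21, e.e31]
  ring

/-- The differential of a vector field `w = κ a₁` is determined modulo `a₁` by the values of `κ`
alone, since `da₁ ≡ α² a₂ - α³ a₃`. -/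
lemma lor_diff_of_eventually_smul {w : M → Mink} {κ : M → ℝ} (hp : p ∈ A.domain)
    (hw : MDifferentiableAt (𝓡 2) 𝓘(ℝ, Mink) w p) (h : ∀ᶠ q in 𝓝 p, w q = κ q • A.a 0 q) :
    lor (diff w p X) (A.a 0 p) = 0 ∧ lor (diff w p X) (A.a 1 p) = κ p * A.θ₂ p X ∧
      lor (diff w p X) (A.a 2 p) = -(κ p * A.θ₃ p X) := by
  have e := A.isNullBasis hp
  have hz (i : Fin 4) (hi : ∀ q ∈ A.domain, lor (A.a 0 q) (A.a i q) = 0) :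
      lor (diff w p X) (A.a i p) + lor (w p) (diff (A.a i) p X) = 0 := by
    refine lor_diff_add_of_eventually hw (A.mdiff_a hp i) (c := 0) ?_ X
    filter_upwards [h, A.domain_mem_nhds hp] with q hq hqA
    rw [hq, lor_smul_left, hi q hqA, mul_zero]
  have h0 := hz 0 fun q hq => (A.isNullBasis hq).e11
  have h1 := hz 1 fun q hq => (A.isNullBasis hq).e12
  have h2 := hz 2 fun q hq => (A.isNullBasis hq).e13
  rw [h.self_of_nhds, A.diff_a_zero X hp] at h0
  rw [h.self_of_nhds, A.diff_a_one X hp] at h1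
  rw [h.self_of_nhds, A.diff_a_two X hp] at h2
  simp only [lor_add_right, lor_sub_right, lor_smul_left, lor_smul_right, e.e11, e.e12, e.e13,
    e.e14] at h0 h1 h2
  refine ⟨?_, ?_, ?_⟩ <;> linarith

end MiddleFrameField

end

/-! ### Uniqueness of middle frames -/

lemma exists_of_isotropicLine_eq {x v y w : Mink} (h : isotropicLine x v = isotropicLine y w) :
    ∃ s r : ℝ, y = x + s • v ∧ w = r • v := by
  have h1 : y ∈ isotropicLine x v := h ▸ ⟨0, by simp⟩
  have h2 : y + w ∈ isotropicLine x v := h ▸ ⟨1, by simp⟩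
  obtain ⟨s, hs⟩ := h1
  obtain ⟨t, ht⟩ := h2
  refine ⟨s, t - s, hs, ?_⟩
  rw [hs, add_assoc] at ht
  rw [sub_smul, ← add_left_cancel ht, add_sub_cancel_left]

lemma pos_of_smul_mem_posLightCone {v : Mink} {r : ℝ} (hv : v ∈ posLightCone)
    (hw : r • v ∈ posLightCone) : 0 < r := by
  have h1 := hv.2
  have h2 := hw.2
  rw [lor_smul_left] at h2
  by_contra hr
  nlinarith

/-- The linear part of `planeVec`; it is a homothety onto its image, with factor `1 / √2`. -/
def planeVecLin : EuclideanSpace ℝ (Fin 3) →L[ℝ] Mink :=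
  LinearMap.toContinuousLinearMap
    { toFun := fun m => ![m 0 / 2, m 1 / √2, m 2 / √2, -m 0 / 2]
      map_add' := fun m k => by
        ext i
        fin_cases i <;> simp <;> ring
      map_smul' := fun c m => by
        ext i
        fin_cases i <;> simp <;> ring }

lemma planeVecLin_apply (m : EuclideanSpace ℝ (Fin 3)) :
    planeVecLin m = ![m 0 / 2, m 1 / √2, m 2 / √2, -m 0 / 2] := rfl

lemma hasFDerivAt_planeVec (m : EuclideanSpace ℝ (Fin 3)) :
    HasFDerivAt planeVec planeVecLin m := by
  have h : planeVec = fun k => planeVec 0 + planeVecLin k := by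
    ext k i
    rw [planeVecLin_apply]
    fin_cases i <;> simp [planeVec] <;> ring
  rw [h]
  exact planeVecLin.hasFDerivAt.const_add _

lemma lor_planeVecLin (m : EuclideanSpace ℝ (Fin 3)) :
    lor (planeVecLin m) (planeVecLin m) = inner ℝ m m / 2 := by
  have h2 : (√2) ^ 2 = 2 := Real.sq_sqrt (by norm_num)
  rw [real_inner_self_eq_norm_sq, EuclideanSpace.norm_sq_eq, planeVecLin_apply, lor]
  simp only [Fin.sum_univ_three, Real.norm_eq_abs, sq_abs, Matrix.cons_val]
  rw [div_mul_div_comm, div_mul_div_comm, div_mul_div_comm, div_mul_div_comm, ← sq √2, h2]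
  ring

section

variable {M : Type*} [TopologicalSpace M] [ChartedSpace (EuclideanSpace ℝ (Fin 2)) M]

lemma diff_comp {E E' : Type*} [NormedAddCommGroup E] [NormedSpace ℝ E] [NormedAddCommGroup E']
    [NormedSpace ℝ E'] {f : M → E} {g : E → E'} {g' : E →L[ℝ] E'} {p : M}
    (hg : HasFDerivAt g g' (f p)) (hf : MDifferentiableAt (𝓡 2) 𝓘(ℝ, E) f p)
    (X : TangentSpace (𝓡 2) p) : diff (fun q => g (f q)) p X = g' (diff f p X) := by
  have := (HasMFDerivAt.comp p hg.hasMFDerivAt hf.hasMFDerivAt).mfderiv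
  unfold diff
  exact congrArg (fun L => L X) this

variable {F : LegendreImmersion M}

namespace MiddleFrameField

variable (A B : MiddleFrameField F) {p : M}

lemma exists_smul_of_mem (hA : p ∈ A.domain) (hB : p ∈ B.domain) :
    ∃ s r : ℝ, 0 < r ∧ B.a₀ p = A.a₀ p + s • A.a 0 p ∧ B.a 0 p = r • A.a 0 p := by
  obtain ⟨s, r, h1, h2⟩ := exists_of_isotropicLine_eq
    ((A.line_eq p hA).trans (B.line_eq p hB).symm)
  refine ⟨s, r, pos_of_smul_mem_posLightCone (A.isBasis p hA).fst_mem ?_, h1, h2⟩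
  have := (B.isBasis p hB).fst_mem
  rwa [h2] at this

/-- The 1-form `φ`, as a linear map. -/
def φLin (A : MiddleFrameField F) (hA : p ∈ A.domain) : TangentSpace (𝓡 2) p →ₗ[ℝ] ℂ where
  toFun := A.φ p
  map_add' X Y := by
    simp only [FrameField.φ, ← A.lor_diff_a₀_one _ hA, ← A.lor_diff_a₀_two _ hA, map_add]
    rw [lor_add_left, lor_add_left]
    push_cast; ring
  map_smul' c X := by
    simp only [FrameField.φ, ← A.lor_diff_a₀_one _ hA, ← A.lor_diff_a₀_two _ hA, map_smul]
    rw [lor_smul_left, lor_smul_left]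
    simp only [RingHom.id_apply, Complex.real_smul]
    push_cast; ring

lemma re_φ (A : FrameField F) (X : TangentSpace (𝓡 2) p) : (A.φ p X).re = A.θ₂ p X := by
  simp [FrameField.φ]

lemma im_φ (A : FrameField F) (X : TangentSpace (𝓡 2) p) : (A.φ p X).im = A.θ₃ p X := by
  simp [FrameField.φ]

/-- The normal vector `v(n)` is a multiple of `a₁`, so `dn · dn` is a multiple of
`(α²)² + (α³)²`. Hence `φ` vanishes on no tangent vector. -/
lemma φLin_injective (hA : p ∈ A.domain) : Function.Injective (A.φLin hA) := by
  rw [injective_iff_map_eq_zero]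
  intro X hX
  by_contra hX0
  have hpos := F.third_pos p X hX0
  have hn : MDifferentiableAt (𝓡 2) 𝓘(ℝ, EuclideanSpace ℝ (Fin 3)) F.n p :=
    F.smooth_n.mdifferentiableAt (by simp)
  have hN : MDifferentiableAt (𝓡 2) 𝓘(ℝ, Mink) (fun q => planeVec (F.n q)) p :=
    (hasFDerivAt_planeVec _).differentiableAt.comp_mdifferentiableAt hn
  have hex : ∀ q, ∃ k : ℝ, q ∈ A.domain → planeVec (F.n q) = k • A.a 0 q := fun q => by
    by_cases hq : q ∈ A.domain
    · obtain ⟨-, k, -, hk⟩ := exists_of_isotropicLine_eq (A.line_eq q hq)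
      exact ⟨k, fun _ => hk⟩
    · exact ⟨0, fun h => absurd h hq⟩
  choose κ hκ using hex
  obtain ⟨h0, h1, h2⟩ := A.lor_diff_of_eventually_smul X hA hN
    (Filter.mem_of_superset (A.domain_mem_nhds hA) hκ)
  have h3 : A.θ₂ p X = 0 := by rw [← re_φ]; exact congrArg Complex.re hX
  have h4 : A.θ₃ p X = 0 := by rw [← im_φ]; exact congrArg Complex.im hX
  have h5 := (A.isNullBasis hA).lor_eq_of_orthogonal h0 h0
  rw [h1, h2, h3, h4, diff_comp (hasFDerivAt_planeVec _) hn, lor_planeVecLin] at h5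
  linarith

lemma exists_φ_eq (hA : p ∈ A.domain) (c : ℂ) : ∃ X : TangentSpace (𝓡 2) p, A.φ p X = c := by
  have hfin : Module.finrank ℝ (TangentSpace (𝓡 2) p) = Module.finrank ℝ ℂ := by
    rw [Complex.finrank_real_complex]
    exact finrank_euclideanSpace_fin
  have : FiniteDimensional ℝ (TangentSpace (𝓡 2) p) :=
    inferInstanceAs (FiniteDimensional ℝ (EuclideanSpace ℝ (Fin 2)))
  exact (LinearMap.injective_iff_surjective_of_finrank_eq_finrank hfin).1 (A.φLin_injective hA) c

lemma exists_θ_eq (hA : p ∈ A.domain) (x y : ℝ) :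
    ∃ X : TangentSpace (𝓡 2) p, A.θ₂ p X = x ∧ A.θ₃ p X = y := by
  obtain ⟨X, hX⟩ := A.exists_φ_eq hA ⟨x, y⟩
  exact ⟨X, by rw [← re_φ, hX], by rw [← im_φ, hX]⟩

/-- Two middle frames have the same `a₀` and `a₁`. The line `F` leaves the freedom
`ã₀ = a₀ + s a₁`, `ã₁ = r a₁`; the forms `⟨dã₀, dã₀⟩` and `⟨dã₁, dã₁⟩` of a middle frame
coincide, which gives `(1 + s)² = r² = (1 - s)²`. -/
lemma a₀_eq_and_a_zero_eq (hA : p ∈ A.domain) (hB : p ∈ B.domain) :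
    B.a₀ p = A.a₀ p ∧ B.a 0 p = A.a 0 p := by
  have hex : ∀ q, ∃ s r : ℝ, q ∈ A.domain ∩ B.domain →
      0 < r ∧ B.a₀ q = A.a₀ q + s • A.a 0 q ∧ B.a 0 q = r • A.a 0 q := fun q => by
    by_cases hq : q ∈ A.domain ∩ B.domain
    · obtain ⟨s, r, h⟩ := A.exists_smul_of_mem B hq.1 hq.2
      exact ⟨s, r, fun _ => h⟩
    · exact ⟨0, 0, fun h => absurd h hq⟩
  choose s r h using hex
  have hAB : A.domain ∩ B.domain ∈ 𝓝 p := inter_mem (A.domain_mem_nhds hA) (B.domain_mem_nhds hB)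
  have hd0 : MDifferentiableAt (𝓡 2) 𝓘(ℝ, Mink) (fun q => B.a₀ q - A.a₀ q) p :=
    (B.mdiff_a₀ hB).sub (A.mdiff_a₀ hA)
  have e := A.isNullBasis hA
  have key (X : TangentSpace (𝓡 2) p) :
      r p ^ 2 * (A.θ₂ p X ^ 2 + A.θ₃ p X ^ 2) =
        (1 + s p) ^ 2 * A.θ₂ p X ^ 2 + (1 - s p) ^ 2 * A.θ₃ p X ^ 2 := by
    obtain ⟨u0, u1, u2⟩ := A.lor_diff_of_eventually_smul (κ := s) X hA hd0 (by
      filter_upwards [hAB] with q hq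
      rw [(h q hq).2.1, add_sub_cancel_left])
    obtain ⟨v0, v1, v2⟩ := A.lor_diff_of_eventually_smul (κ := r) X hA (B.mdiff_a hB 0) (by
      filter_upwards [hAB] with q hq
      exact (h q hq).2.2)
    rw [diff_sub (B.mdiff_a₀ hB) (A.mdiff_a₀ hA), lor_sub_left, A.diff_a₀ X hA] at u0 u1 u2
    simp only [lor_add_left, lor_smul_left, e.e21, e.e22, e.e23, e.e31, e.e32, e.e33] at u0 u1 u2
    have w0 : lor (diff B.a₀ p X) (A.a 0 p) = 0 := by linarith
    have w1 : lor (diff B.a₀ p X) (A.a 1 p) = (1 + s p) * A.θ₂ p X := by linarith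
    have w2 : lor (diff B.a₀ p X) (A.a 2 p) = (1 - s p) * A.θ₃ p X := by linarith
    have h1 := e.lor_eq_of_orthogonal w0 w0
    have h2 := e.lor_eq_of_orthogonal v0 v0
    rw [w1, w2, B.lor_diff_a₀_self X hB] at h1
    rw [v1, v2, B.lor_diff_a_zero_self X hB] at h2
    linarith
  obtain ⟨X, hX1, hX2⟩ := A.exists_θ_eq hA 1 0
  obtain ⟨Y, hY1, hY2⟩ := A.exists_θ_eq hA 0 1
  have k1 := key X
  have k2 := key Y
  rw [hX1, hX2] at k1
  rw [hY1, hY2] at k2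
  obtain ⟨hr, h0, h1⟩ := h p ⟨hA, hB⟩
  have hs : s p = 0 := by linarith
  have hr1 : r p = 1 := by rw [hs] at k1; nlinarith
  rw [h0, h1, hs, hr1]
  simp

/-- Two middle frames agree up to the sign of `(a₂, a₃)`. -/
lemma exists_sign (hA : p ∈ A.domain) (hB : p ∈ B.domain) :
    ∃ ε : ℝ, ε ^ 2 = 1 ∧ B.a 1 p = ε • A.a 1 p ∧ B.a 2 p = ε • A.a 2 p ∧ B.a 3 p = A.a 3 p := by
  have hAB : A.domain ∩ B.domain ∈ 𝓝 p := inter_mem (A.domain_mem_nhds hA) (B.domain_mem_nhds hB)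
  have e := A.isNullBasis hA
  have f := B.isNullBasis hB
  have h00 := (A.a₀_eq_and_a_zero_eq B hA hB).2
  have hd0 (X : TangentSpace (𝓡 2) p) : diff B.a₀ p X = diff A.a₀ p X := diff_congr
    (Filter.mem_of_superset hAB fun q hq => (A.a₀_eq_and_a_zero_eq B hq.1 hq.2).1) X
  have hd1 (X : TangentSpace (𝓡 2) p) : diff (B.a 0) p X = diff (A.a 0) p X := diff_congr
    (Filter.mem_of_superset hAB fun q hq => (A.a₀_eq_and_a_zero_eq B hq.1 hq.2).2) X
  -- `a₀` and `a₁` agree, hence so do `⟨da₀, da₀⟩ ± ⟨da₀, da₁⟩ = 2 (α²)², 2 (α³)²`.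
  have hsq (X : TangentSpace (𝓡 2) p) :
      B.θ₂ p X ^ 2 = A.θ₂ p X ^ 2 ∧ B.θ₃ p X ^ 2 = A.θ₃ p X ^ 2 := by
    have h1 := B.lor_diff_a₀_self X hB
    have h2 := B.lor_diff_a₀_diff_a_zero X hB
    rw [hd0, A.lor_diff_a₀_self X hA] at h1
    rw [hd0, hd1, A.lor_diff_a₀_diff_a_zero X hA] at h2
    constructor <;> linarith
  obtain ⟨X, hX1, hX2⟩ := A.exists_θ_eq hA 1 0
  obtain ⟨Y, hY1, hY2⟩ := A.exists_θ_eq hA 0 1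
  obtain ⟨x1, x2⟩ := hsq X
  obtain ⟨y1, y2⟩ := hsq Y
  rw [hX1] at x1
  rw [hX2] at x2
  rw [hY1] at y1
  rw [hY2] at y2
  have x2' : B.θ₃ p X = 0 := by simpa using x2
  have y1' : B.θ₂ p Y = 0 := by simpa using y1
  have a1 := hd0 X
  have a2 := hd0 Y
  rw [A.diff_a₀ _ hA, B.diff_a₀ _ hB, hX1, hX2, x2'] at a1
  rw [A.diff_a₀ _ hA, B.diff_a₀ _ hB, hY1, hY2, y1'] at a2
  set ε := B.θ₂ p X
  set ε' := B.θ₃ p Y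
  have hε : ε ^ 2 = 1 := by simpa using x1
  have hε' : ε' ^ 2 = 1 := by simpa using y2
  have b1 : B.a 1 p = ε • A.a 1 p := by
    have : ε • (ε • B.a 1 p) = ε • A.a 1 p := by simpa using congrArg (ε • ·) a1
    rwa [smul_smul, ← sq, hε, one_smul] at this
  have b2 : B.a 2 p = ε' • A.a 2 p := by
    have : ε' • (ε' • B.a 2 p) = ε' • A.a 2 p := by simpa using congrArg (ε' • ·) a2
    rwa [smul_smul, ← sq, hε', one_smul] at this
  have hne : ε ≠ 0 := fun h => by rw [h] at hε; norm_num at hε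
  have hne' : ε' ≠ 0 := fun h => by rw [h] at hε'; norm_num at hε'
  -- `a₄` is the null vector orthogonal to `a₂` and `a₃` with `⟨a₄, a₁⟩ = -1`.
  have b3 : B.a 3 p = A.a 3 p := by
    have c0 := f.e41
    have c1 := f.e42
    have c2 := f.e43
    have c3 := f.e44
    rw [h00] at c0
    rw [b1, lor_smul_right] at c1
    rw [b2, lor_smul_right] at c2
    have c1' := (mul_eq_zero.1 c1).resolve_left hne
    have c2' := (mul_eq_zero.1 c2).resolve_left hne'
    have hex := e.expand (B.a 3 p)
    rw [c0, c1', c2'] at hex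
    rw [hex] at c3
    simp only [lor_add_left, lor_add_right, lor_smul_left, lor_smul_right, e.e11, e.e12, e.e13,
      e.e14, e.e21, e.e24, e.e22, e.e23, e.e31, e.e32, e.e33, e.e34, e.e41, e.e44, e.e42,
      e.e43] at c3
    have c4 : lor (B.a 3 p) (A.a 3 p) = 0 := by linarith
    rw [c4] at hex
    rw [hex]
    simp
  -- The determinant condition makes the signs of `a₂` and `a₃` equal.
  have hdet : colMatrix (fun i => B.a i p) =
      colMatrix (fun i => A.a i p) * Matrix.diagonal ![1, ε, ε', 1] := by
    ext i j
    rw [Matrix.mul_diagonal]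
    fin_cases j <;> simp [colMatrix, h00, b1, b2, b3, mul_comm]
  have hdet' := congrArg Matrix.det hdet
  rw [Matrix.det_mul, (A.isBasis p hA).det_eq_one, (B.isBasis p hB).det_eq_one,
    Matrix.det_diagonal, Fin.prod_univ_four] at hdet'
  have hεε : 1 = ε * ε' := by simpa using hdet'
  have : ε' = ε := by
    calc ε' = ε ^ 2 * ε' := by rw [hε, one_mul]
      _ = ε * (ε * ε') := by ring
      _ = ε := by rw [← hεε, mul_one]
  rw [this] at b2
  exact ⟨ε, hε, b1, b2, b3⟩

/-- `φ` is determined up to sign, and `p₁, p₂, p₃` are determined. The latter are read off from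
`da₄`, because `a₄` is the same for all middle frames while `a₂`, `a₃` depend on a sign. -/
lemma invariants_eq (hA : p ∈ A.domain) (hB : p ∈ B.domain) :
    (∃ ε : ℝ, ε ^ 2 = 1 ∧ ∀ X, B.φ p X = ε * A.φ p X) ∧
      B.p₁ p = A.p₁ p ∧ B.p₂ p = A.p₂ p ∧ B.p₃ p = A.p₃ p := by
  have hAB : A.domain ∩ B.domain ∈ 𝓝 p := inter_mem (A.domain_mem_nhds hA) (B.domain_mem_nhds hB)
  have e := A.isNullBasis hA
  have f := B.isNullBasis hB
  obtain ⟨ε, hε, b1, b2, b3⟩ := A.exists_sign B hA hB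
  have hd0 (X : TangentSpace (𝓡 2) p) : diff B.a₀ p X = diff A.a₀ p X := diff_congr
    (Filter.mem_of_superset hAB fun q hq => (A.a₀_eq_and_a_zero_eq B hq.1 hq.2).1) X
  have hd3 (X : TangentSpace (𝓡 2) p) : diff (B.a 3) p X = diff (A.a 3) p X := diff_congr
    (Filter.mem_of_superset hAB fun q hq => by
      obtain ⟨-, -, -, -, h⟩ := A.exists_sign B hq.1 hq.2
      exact h) X
  have h2 (X : TangentSpace (𝓡 2) p) : B.θ₂ p X = ε * A.θ₂ p X := by
    rw [← A.lor_diff_a₀_one X hA, ← B.lor_diff_a₀_one X hB, hd0, b1, lor_smul_right]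
  have h3 (X : TangentSpace (𝓡 2) p) : B.θ₃ p X = ε * A.θ₃ p X := by
    rw [← A.lor_diff_a₀_two X hA, ← B.lor_diff_a₀_two X hB, hd0, b2, lor_smul_right]
  refine ⟨⟨ε, hε, fun X => ?_⟩, ?_⟩
  · rw [FrameField.φ, FrameField.φ, h2, h3]
    push_cast; ring
  have g (C : MiddleFrameField F) (hC : p ∈ C.domain) (X : TangentSpace (𝓡 2) p) :
      lor (diff (C.a 3) p X) (C.a 1 p) = C.p₁ p * C.θ₂ p X + C.p₂ p * C.θ₃ p X ∧
      lor (diff (C.a 3) p X) (C.a 2 p) = C.p₂ p * C.θ₂ p X + C.p₃ p * C.θ₃ p X := by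
    have k := C.isNullBasis hC
    rw [C.diff_a_three X hC]
    simp only [lor_add_left, lor_sub_left, lor_smul_left, k.e22, k.e23, k.e32, k.e33, k.e42, k.e43]
    constructor <;> ring
  have g1 (X : TangentSpace (𝓡 2) p) : B.p₁ p * A.θ₂ p X + B.p₂ p * A.θ₃ p X =
      A.p₁ p * A.θ₂ p X + A.p₂ p * A.θ₃ p X := by
    have u := (g A hA X).1
    have v := (g B hB X).1
    rw [hd3, b1, lor_smul_right, u, h2, h3] at v
    linear_combination (-ε) * v + (A.p₁ p * A.θ₂ p X + A.p₂ p * A.θ₃ p X -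
      B.p₁ p * A.θ₂ p X - B.p₂ p * A.θ₃ p X) * hε
  have g2 (X : TangentSpace (𝓡 2) p) : B.p₂ p * A.θ₂ p X + B.p₃ p * A.θ₃ p X =
      A.p₂ p * A.θ₂ p X + A.p₃ p * A.θ₃ p X := by
    have u := (g A hA X).2
    have v := (g B hB X).2
    rw [hd3, b2, lor_smul_right, u, h2, h3] at v
    linear_combination (-ε) * v + (A.p₂ p * A.θ₂ p X + A.p₃ p * A.θ₃ p X -
      B.p₂ p * A.θ₂ p X - B.p₃ p * A.θ₃ p X) * hε
  obtain ⟨X, hX1, hX2⟩ := A.exists_θ_eq hA 1 0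
  obtain ⟨Y, hY1, hY2⟩ := A.exists_θ_eq hA 0 1
  have k1 := g1 X
  have k2 := g1 Y
  have k3 := g2 Y
  rw [hX1, hX2] at k1
  rw [hY1, hY2] at k2 k3
  refine ⟨?_, ?_, ?_⟩ <;> linarith

lemma mem_middleFrameAt (hA : p ∈ A.domain) : p ∈ (F.middleFrameAt p).domain :=
  Classical.epsilon_spec (p := fun A : MiddleFrameField F => p ∈ A.domain) ⟨A, hA⟩

lemma lGaussMap_eq (hA : p ∈ A.domain) : F.lGaussMap p = A.a₀ p :=
  (A.a₀_eq_and_a_zero_eq _ hA (A.mem_middleFrameAt hA)).1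

lemma quarticDifferential_eq (hA : p ∈ A.domain) (X : TangentSpace (𝓡 2) p) :
    F.quarticDifferential p X =
      (((A.p₁ p - A.p₃ p) / 2 : ℝ) - Complex.I * (A.p₂ p : ℂ)) * A.φ p X ^ 4 := by
  obtain ⟨⟨ε, hε, h⟩, h1, h2, h3⟩ := A.invariants_eq _ hA (A.mem_middleFrameAt hA)
  have hε' : (ε : ℂ) ^ 4 = 1 := by
    rw [show (4 : ℕ) = 2 * 2 from rfl, pow_mul]
    exact_mod_cast by rw [hε, one_pow]
  rw [LegendreImmersion.quarticDifferential, h1, h2, h3, h, mul_pow, hε', one_mul]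

lemma quadraticDifferential_eq (hA : p ∈ A.domain) (X : TangentSpace (𝓡 2) p) :
    F.quadraticDifferential p X = ((A.p₁ p + A.p₃ p : ℝ) : ℂ) * A.φ p X ^ 2 := by
  obtain ⟨⟨ε, hε, h⟩, h1, h2, h3⟩ := A.invariants_eq _ hA (A.mem_middleFrameAt hA)
  have hε' : (ε : ℂ) ^ 2 = 1 := by exact_mod_cast hε
  rw [LegendreImmersion.quadraticDifferential, h1, h3, h, mul_pow, hε', one_mul]

end MiddleFrameField

end

/-! ### Calculus on open subsets of the complex plane -/

lemma fderiv_apply_eq_re_im {E : Type*} [NormedAddCommGroup E] [NormedSpace ℝ E]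
    (L : ℂ →L[ℝ] E) (v : ℂ) : L v = v.re • L 1 + v.im • L Complex.I := by
  conv_lhs => rw [show v = v.re • (1 : ℂ) + v.im • Complex.I by
    simp only [Complex.real_smul, mul_one]
    exact (Complex.re_add_im v).symm]
  rw [map_add, map_smul, map_smul]

lemma fderiv_mul_apply {f g : ℂ → ℝ} {z : ℂ} (hf : DifferentiableAt ℝ f z)
    (hg : DifferentiableAt ℝ g z) (v : ℂ) :
    fderiv ℝ (fun z => f z * g z) z v = fderiv ℝ f z v * g z + f z * fderiv ℝ g z v := by
  rw [fderiv_fun_mul hf hg]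
  simp only [add_apply, smul_apply, smul_eq_mul]
  ring

lemma fderiv_add_apply {f g : ℂ → ℝ} {z : ℂ} (hf : DifferentiableAt ℝ f z)
    (hg : DifferentiableAt ℝ g z) (v : ℂ) :
    fderiv ℝ (fun z => f z + g z) z v = fderiv ℝ f z v + fderiv ℝ g z v := by
  rw [fderiv_fun_add hf hg]; rfl

lemma fderiv_sub_apply {f g : ℂ → ℝ} {z : ℂ} (hf : DifferentiableAt ℝ f z)
    (hg : DifferentiableAt ℝ g z) (v : ℂ) :
    fderiv ℝ (fun z => f z - g z) z v = fderiv ℝ f z v - fderiv ℝ g z v := by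
  rw [fderiv_fun_sub hf hg]; rfl

lemma fderiv_neg_apply (f : ℂ → ℝ) (z v : ℂ) :
    fderiv ℝ (fun z => -f z) z v = -fderiv ℝ f z v := by
  rw [fderiv_fun_neg]; rfl

lemma fderiv_lor_apply {f g : ℂ → Mink} {z : ℂ} (hf : DifferentiableAt ℝ f z)
    (hg : DifferentiableAt ℝ g z) (v : ℂ) : fderiv ℝ (fun z => lor (f z) (g z)) z v =
      lor (fderiv ℝ f z v) (g z) + lor (f z) (fderiv ℝ g z v) := by
  have := (lorL.hasFDerivAt_of_bilinear hf.hasFDerivAt hg.hasFDerivAt).fderiv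
  refine (congrArg (fun L => L v) this).trans ?_
  rw [add_comm]; rfl

lemma differentiableAt_lor {f g : ℂ → Mink} {z : ℂ} (hf : DifferentiableAt ℝ f z)
    (hg : DifferentiableAt ℝ g z) : DifferentiableAt ℝ (fun z => lor (f z) (g z)) z :=
  (lorL.hasFDerivAt_of_bilinear hf.hasFDerivAt hg.hasFDerivAt).differentiableAt

lemma fderiv_eq_of_eqOn {E : Type*} [NormedAddCommGroup E] [NormedSpace ℝ E] {Ω : Set ℂ}
    (hΩ : IsOpen Ω) {f g : ℂ → E} (h : ∀ z ∈ Ω, f z = g z) {z : ℂ} (hz : z ∈ Ω) :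
    fderiv ℝ f z = fderiv ℝ g z :=
  Filter.EventuallyEq.fderiv_eq (Filter.mem_of_superset (hΩ.mem_nhds hz) h)

section

variable {E : Type*} [NormedAddCommGroup E] [NormedSpace ℝ E] {Ω : Set ℂ} {f : ℂ → E} {z : ℂ}

lemma differentiableAt_of_smoothOn (hΩ : IsOpen Ω) (hf : ContDiffOn ℝ ∞ f Ω) (hz : z ∈ Ω) :
    DifferentiableAt ℝ f z :=
  (hf.contDiffAt (hΩ.mem_nhds hz)).differentiableAt (by simp)

lemma contDiffOn_fderiv_apply (hΩ : IsOpen Ω) (hf : ContDiffOn ℝ ∞ f Ω) (v : ℂ) :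
    ContDiffOn ℝ ∞ (fun z => fderiv ℝ f z v) Ω :=
  (hf.fderiv_of_isOpen hΩ (by simp)).clm_apply contDiffOn_const

/-- Symmetry of the second derivative. -/
lemma fderiv_fderiv_comm (hΩ : IsOpen Ω) (hf : ContDiffOn ℝ ∞ f Ω) (hz : z ∈ Ω) (v w : ℂ) :
    fderiv ℝ (fun z => fderiv ℝ f z v) z w = fderiv ℝ (fun z => fderiv ℝ f z w) z v := by
  have hd : DifferentiableAt ℝ (fderiv ℝ f) z :=
    differentiableAt_of_smoothOn hΩ (hf.fderiv_of_isOpen hΩ (m := ∞) (by simp)) hz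
  have hs : IsSymmSndFDerivAt ℝ f z :=
    (hf.contDiffAt (hΩ.mem_nhds hz)).isSymmSndFDerivAt (by
      simpa using WithTop.coe_le_coe.2 (le_top : (2 : ℕ∞) ≤ ⊤))
  have (u : ℂ) : fderiv ℝ (fun z => fderiv ℝ f z u) z = (fderiv ℝ (fderiv ℝ f) z).flip u := by
    rw [fderiv_clm_apply hd (by fun_prop)]
    simp
  rw [this, this]
  exact hs.eq w v

end

/-- The integrability condition for a vector-valued function `f`, paired with a field `g`. -/
lemma fderiv_lor_mixed {Ω : Set ℂ} (hΩ : IsOpen Ω) {f g : ℂ → Mink} (hf : ContDiffOn ℝ ∞ f Ω)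
    (hg : ContDiffOn ℝ ∞ g Ω) {u w : ℂ → ℝ} (hu : ∀ z ∈ Ω, lor (fderiv ℝ f z 1) (g z) = u z)
    (hw : ∀ z ∈ Ω, lor (fderiv ℝ f z Complex.I) (g z) = w z) {z : ℂ} (hz : z ∈ Ω) :
    fderiv ℝ u z Complex.I - fderiv ℝ w z 1 =
      lor (fderiv ℝ f z 1) (fderiv ℝ g z Complex.I) -
        lor (fderiv ℝ f z Complex.I) (fderiv ℝ g z 1) := by
  have hd (v : ℂ) := differentiableAt_of_smoothOn hΩ (contDiffOn_fderiv_apply hΩ hf v) hz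
  have hgd := differentiableAt_of_smoothOn hΩ hg hz
  rw [← fderiv_eq_of_eqOn hΩ hu hz, ← fderiv_eq_of_eqOn hΩ hw hz, fderiv_lor_apply (hd _) hgd,
    fderiv_lor_apply (hd _) hgd, fderiv_fderiv_comm hΩ hf hz 1 Complex.I]
  ring

/-! ### Middle frames in a conformal coordinate -/

/-- A middle frame `(a₀, e₁, e₂, e₃, e₄)` written in a coordinate `z` on an open set `Ω` of `ℂ`
in which `φ = (r + i t) dz`. The 1-forms `α² = r dx - t dy` and `α³ = t dx + r dy` appear in
components: `v.re`, `v.im` are the values of `dx`, `dy` on `v`. -/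
structure ConformalFrame where
  Ω : Set ℂ
  isOpen : IsOpen Ω
  a₀ : ℂ → Mink
  e₁ : ℂ → Mink
  e₂ : ℂ → Mink
  e₃ : ℂ → Mink
  e₄ : ℂ → Mink
  p₁ : ℂ → ℝ
  p₂ : ℂ → ℝ
  p₃ : ℂ → ℝ
  q₁ : ℂ → ℝ
  q₂ : ℂ → ℝ
  r : ℂ → ℝ
  t : ℂ → ℝ
  smooth_a₀ : ContDiffOn ℝ ∞ a₀ Ω
  smooth_e₁ : ContDiffOn ℝ ∞ e₁ Ω
  smooth_e₂ : ContDiffOn ℝ ∞ e₂ Ω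
  smooth_e₃ : ContDiffOn ℝ ∞ e₃ Ω
  smooth_e₄ : ContDiffOn ℝ ∞ e₄ Ω
  smooth_p₁ : ContDiffOn ℝ ∞ p₁ Ω
  smooth_p₂ : ContDiffOn ℝ ∞ p₂ Ω
  smooth_p₃ : ContDiffOn ℝ ∞ p₃ Ω
  smooth_q₁ : ContDiffOn ℝ ∞ q₁ Ω
  smooth_q₂ : ContDiffOn ℝ ∞ q₂ Ω
  smooth_r : ContDiffOn ℝ ∞ r Ω
  smooth_t : ContDiffOn ℝ ∞ t Ω
  isNullBasis : ∀ z ∈ Ω, IsNullBasis (e₁ z) (e₂ z) (e₃ z) (e₄ z)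
  ne_zero : ∀ z ∈ Ω, r z ^ 2 + t z ^ 2 ≠ 0
  fderiv_a₀ : ∀ z ∈ Ω, ∀ v, fderiv ℝ a₀ z v =
    (r z * v.re - t z * v.im) • e₂ z + (t z * v.re + r z * v.im) • e₃ z
  fderiv_e₁ : ∀ z ∈ Ω, ∀ v, fderiv ℝ e₁ z v =
    (2 * q₂ z * (r z * v.re - t z * v.im) - 2 * q₁ z * (t z * v.re + r z * v.im)) • e₁ z +
      (r z * v.re - t z * v.im) • e₂ z - (t z * v.re + r z * v.im) • e₃ z
  fderiv_e₂ : ∀ z ∈ Ω, ∀ v, fderiv ℝ e₂ z v =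
    (p₁ z * (r z * v.re - t z * v.im) + p₂ z * (t z * v.re + r z * v.im)) • e₁ z +
      (q₁ z * (r z * v.re - t z * v.im) + q₂ z * (t z * v.re + r z * v.im)) • e₃ z +
      (r z * v.re - t z * v.im) • e₄ z
  fderiv_e₃ : ∀ z ∈ Ω, ∀ v, fderiv ℝ e₃ z v =
    (p₂ z * (r z * v.re - t z * v.im) + p₃ z * (t z * v.re + r z * v.im)) • e₁ z -
      (q₁ z * (r z * v.re - t z * v.im) + q₂ z * (t z * v.re + r z * v.im)) • e₂ z -
      (t z * v.re + r z * v.im) • e₄ z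
  fderiv_e₄ : ∀ z ∈ Ω, ∀ v, fderiv ℝ e₄ z v =
    (p₁ z * (r z * v.re - t z * v.im) + p₂ z * (t z * v.re + r z * v.im)) • e₂ z +
      (p₂ z * (r z * v.re - t z * v.im) + p₃ z * (t z * v.re + r z * v.im)) • e₃ z -
      (2 * q₂ z * (r z * v.re - t z * v.im) - 2 * q₁ z * (t z * v.re + r z * v.im)) • e₄ z

namespace ConformalFrame

variable (C : ConformalFrame) {z : ℂ}

/-- The 1-form `τ = 2 (q₂ α² - q₁ α³)`. -/
def τ (z v : ℂ) : ℝ :=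
  2 * C.q₂ z * (C.r z * v.re - C.t z * v.im) - 2 * C.q₁ z * (C.t z * v.re + C.r z * v.im)

/-- The half sum `s = (p₁ + p₃) / 2`. -/
def s (z : ℂ) : ℝ := (C.p₁ z + C.p₃ z) / 2

/-- The half difference `d = (p₁ - p₃) / 2`. -/
def d (z : ℂ) : ℝ := (C.p₁ z - C.p₃ z) / 2

lemma diffAt {E : Type*} [NormedAddCommGroup E] [NormedSpace ℝ E] {f : ℂ → E}
    (hf : ContDiffOn ℝ ∞ f C.Ω) (hz : z ∈ C.Ω) : DifferentiableAt ℝ f z :=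
  differentiableAt_of_smoothOn C.isOpen hf hz

lemma smooth_s : ContDiffOn ℝ ∞ C.s C.Ω := (C.smooth_p₁.add C.smooth_p₃).div_const 2

lemma smooth_τ (v : ℂ) : ContDiffOn ℝ ∞ (fun z => C.τ z v) C.Ω := by
  have h1 := C.smooth_q₁
  have h2 := C.smooth_q₂
  have h3 := C.smooth_r
  have h4 := C.smooth_t
  unfold τ
  fun_prop

lemma fderiv_s (hz : z ∈ C.Ω) (v : ℂ) : fderiv ℝ C.s z v =
    (fderiv ℝ C.p₁ z v + fderiv ℝ C.p₃ z v) / 2 := by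
  have h := (((C.diffAt C.smooth_p₁ hz).hasFDerivAt.add
    (C.diffAt C.smooth_p₃ hz).hasFDerivAt).mul_const (2 : ℝ)⁻¹).fderiv
  refine (congrArg (fun L => L v) h).trans ?_
  simp only [add_apply, smul_apply, smul_eq_mul]
  ring

lemma fderiv_d (hz : z ∈ C.Ω) (v : ℂ) : fderiv ℝ C.d z v =
    (fderiv ℝ C.p₁ z v - fderiv ℝ C.p₃ z v) / 2 := by
  have h := (((C.diffAt C.smooth_p₁ hz).hasFDerivAt.sub
    (C.diffAt C.smooth_p₃ hz).hasFDerivAt).mul_const (2 : ℝ)⁻¹).fderiv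
  refine (congrArg (fun L => L v) h).trans ?_
  simp only [sub_apply, smul_apply, smul_eq_mul]
  ring

/-! ### The structure equations -/

/-- `dα² = q₁ α² ∧ α³`, the `a₂`-component of `d(da₀) = 0`. -/
lemma structure_α (hz : z ∈ C.Ω) : fderiv ℝ C.r z Complex.I + fderiv ℝ C.t z 1 =
    -C.q₁ z * (C.r z ^ 2 + C.t z ^ 2) := by
  have e := C.isNullBasis z hz
  have h := fderiv_lor_mixed C.isOpen C.smooth_a₀ C.smooth_e₂ (u := C.r) (w := fun z => -C.t z)
    (fun z hz => by
      have e := C.isNullBasis z hz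
      rw [C.fderiv_a₀ z hz]
      simp only [lor_add_left, lor_smul_left, e.e22, e.e32, Complex.one_re, Complex.one_im]
      ring)
    (fun z hz => by
      have e := C.isNullBasis z hz
      rw [C.fderiv_a₀ z hz]
      simp only [lor_add_left, lor_smul_left, e.e22, e.e32, Complex.I_re, Complex.I_im]
      ring) hz
  rw [fderiv_neg_apply, C.fderiv_a₀ z hz, C.fderiv_a₀ z hz, C.fderiv_e₂ z hz,
    C.fderiv_e₂ z hz] at h
  simp only [lor_add_left, lor_smul_left, lor_add_right, lor_smul_right, e.e21, e.e23, e.e24,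
    e.e31, e.e33, e.e34, Complex.one_re, Complex.one_im, Complex.I_re, Complex.I_im] at h
  linear_combination h

/-- `dα³ = q₂ α² ∧ α³`, the `a₃`-component of `d(da₀) = 0`. -/
lemma structure_β (hz : z ∈ C.Ω) : fderiv ℝ C.r z 1 - fderiv ℝ C.t z Complex.I =
    C.q₂ z * (C.r z ^ 2 + C.t z ^ 2) := by
  have e := C.isNullBasis z hz
  have h := fderiv_lor_mixed C.isOpen C.smooth_a₀ C.smooth_e₃ (u := C.t) (w := C.r)
    (fun z hz => by
      have e := C.isNullBasis z hz
      rw [C.fderiv_a₀ z hz]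
      simp only [lor_add_left, lor_smul_left, e.e23, e.e33, Complex.one_re, Complex.one_im]
      ring)
    (fun z hz => by
      have e := C.isNullBasis z hz
      rw [C.fderiv_a₀ z hz]
      simp only [lor_add_left, lor_smul_left, e.e23, e.e33, Complex.I_re, Complex.I_im]
      ring) hz
  rw [C.fderiv_a₀ z hz, C.fderiv_a₀ z hz, C.fderiv_e₃ z hz, C.fderiv_e₃ z hz] at h
  simp only [lor_add_left, lor_smul_left, lor_sub_right, lor_smul_right, e.e21, e.e22, e.e24,
    e.e31, e.e32, e.e34, Complex.one_re, Complex.one_im, Complex.I_re, Complex.I_im] at h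
  linear_combination -h

/-- `dτ = 2 p₂ α² ∧ α³`, the `a₁`-component of `d(da₁) = 0`. -/
lemma structure_τ (hz : z ∈ C.Ω) :
    fderiv ℝ (fun z => C.τ z Complex.I) z 1 - fderiv ℝ (fun z => C.τ z 1) z Complex.I =
      2 * C.p₂ z * (C.r z ^ 2 + C.t z ^ 2) := by
  have e := C.isNullBasis z hz
  have h := fderiv_lor_mixed C.isOpen C.smooth_e₁ C.smooth_e₄ (u := fun z => -C.τ z 1)
    (w := fun z => -C.τ z Complex.I)
    (fun z hz => by
      have e := C.isNullBasis z hz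
      rw [C.fderiv_e₁ z hz]
      simp only [lor_add_left, lor_sub_left, lor_smul_left, e.e14, e.e24, e.e34, τ,
        Complex.one_re, Complex.one_im]
      ring)
    (fun z hz => by
      have e := C.isNullBasis z hz
      rw [C.fderiv_e₁ z hz]
      simp only [lor_add_left, lor_sub_left, lor_smul_left, e.e14, e.e24, e.e34, τ,
        Complex.I_re, Complex.I_im]
      ring) hz
  rw [fderiv_neg_apply, fderiv_neg_apply, C.fderiv_e₁ z hz, C.fderiv_e₁ z hz, C.fderiv_e₄ z hz,
    C.fderiv_e₄ z hz] at h
  simp only [lor_add_left, lor_sub_left, lor_smul_left, lor_add_right, lor_sub_right,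
    lor_smul_right, e.e12, e.e13, e.e14, e.e22, e.e23, e.e24, e.e32, e.e33, e.e34,
    Complex.one_re, Complex.one_im, Complex.I_re, Complex.I_im] at h
  linear_combination h

/-- The `a₁`-component of `d(da₂) = 0`. -/
lemma codazzi₁ (hz : z ∈ C.Ω) :
    -C.t z * fderiv ℝ C.p₁ z 1 - C.r z * fderiv ℝ C.p₁ z Complex.I +
      C.r z * fderiv ℝ C.p₂ z 1 - C.t z * fderiv ℝ C.p₂ z Complex.I =
    (-3 * C.p₁ z * C.q₁ z - 4 * C.p₂ z * C.q₂ z + C.q₁ z * C.p₃ z) *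
      (C.r z ^ 2 + C.t z ^ 2) := by
  have e := C.isNullBasis z hz
  have h := fderiv_lor_mixed C.isOpen C.smooth_e₂ C.smooth_e₄
    (u := fun z => -(C.p₁ z * C.r z + C.p₂ z * C.t z))
    (w := fun z => -(C.p₂ z * C.r z - C.p₁ z * C.t z))
    (fun z hz => by
      have e := C.isNullBasis z hz
      rw [C.fderiv_e₂ z hz]
      simp only [lor_add_left, lor_smul_left, e.e14, e.e34, e.e44, Complex.one_re, Complex.one_im]
      ring)
    (fun z hz => by
      have e := C.isNullBasis z hz
      rw [C.fderiv_e₂ z hz]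
      simp only [lor_add_left, lor_smul_left, e.e14, e.e34, e.e44, Complex.I_re, Complex.I_im]
      ring) hz
  have d1 := C.diffAt C.smooth_p₁ hz
  have d2 := C.diffAt C.smooth_p₂ hz
  have dr := C.diffAt C.smooth_r hz
  have dt := C.diffAt C.smooth_t hz
  rw [fderiv_neg_apply, fderiv_neg_apply, fderiv_add_apply (d1.fun_mul dr) (d2.fun_mul dt),
    fderiv_sub_apply (d2.fun_mul dr) (d1.fun_mul dt), fderiv_mul_apply d1 dr,
    fderiv_mul_apply d2 dt,
    fderiv_mul_apply d2 dr, fderiv_mul_apply d1 dt, C.fderiv_e₂ z hz, C.fderiv_e₂ z hz,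
    C.fderiv_e₄ z hz, C.fderiv_e₄ z hz] at h
  simp only [lor_add_left, lor_smul_left, lor_add_right, lor_sub_right,
    lor_smul_right, e.e12, e.e13, e.e14, e.e32, e.e33, e.e34, e.e42, e.e43, e.e44,
    Complex.one_re, Complex.one_im, Complex.I_re, Complex.I_im] at h
  linear_combination h + C.p₁ z * C.structure_α hz - C.p₂ z * C.structure_β hz

/-- The `a₁`-component of `d(da₃) = 0`. -/
lemma codazzi₂ (hz : z ∈ C.Ω) :
    -C.t z * fderiv ℝ C.p₂ z 1 - C.r z * fderiv ℝ C.p₂ z Complex.I +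
      C.r z * fderiv ℝ C.p₃ z 1 - C.t z * fderiv ℝ C.p₃ z Complex.I =
    (-4 * C.p₂ z * C.q₁ z - 3 * C.p₃ z * C.q₂ z + C.q₂ z * C.p₁ z) *
      (C.r z ^ 2 + C.t z ^ 2) := by
  have e := C.isNullBasis z hz
  have h := fderiv_lor_mixed C.isOpen C.smooth_e₃ C.smooth_e₄
    (u := fun z => -(C.p₂ z * C.r z + C.p₃ z * C.t z))
    (w := fun z => -(C.p₃ z * C.r z - C.p₂ z * C.t z))
    (fun z hz => by
      have e := C.isNullBasis z hz
      rw [C.fderiv_e₃ z hz]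
      simp only [lor_sub_left, lor_smul_left, e.e14, e.e24, e.e44, Complex.one_re, Complex.one_im]
      ring)
    (fun z hz => by
      have e := C.isNullBasis z hz
      rw [C.fderiv_e₃ z hz]
      simp only [lor_sub_left, lor_smul_left, e.e14, e.e24, e.e44, Complex.I_re, Complex.I_im]
      ring) hz
  have d3 := C.diffAt C.smooth_p₃ hz
  have d2 := C.diffAt C.smooth_p₂ hz
  have dr := C.diffAt C.smooth_r hz
  have dt := C.diffAt C.smooth_t hz
  rw [fderiv_neg_apply, fderiv_neg_apply, fderiv_add_apply (d2.fun_mul dr) (d3.fun_mul dt),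
    fderiv_sub_apply (d3.fun_mul dr) (d2.fun_mul dt), fderiv_mul_apply d2 dr,
    fderiv_mul_apply d3 dt,
    fderiv_mul_apply d3 dr, fderiv_mul_apply d2 dt, C.fderiv_e₃ z hz, C.fderiv_e₃ z hz,
    C.fderiv_e₄ z hz, C.fderiv_e₄ z hz] at h
  simp only [lor_sub_left, lor_smul_left, lor_add_right, lor_sub_right,
    lor_smul_right, e.e12, e.e13, e.e14, e.e22, e.e23, e.e24, e.e42, e.e43, e.e44,
    Complex.one_re, Complex.one_im, Complex.I_re, Complex.I_im] at h
  linear_combination h + C.p₂ z * C.structure_α hz - C.p₃ z * C.structure_β hz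

/-! ### Holomorphic quartic differential -/

/-- The coefficient `μ = r + i t` of `φ = μ dz`. -/
def μ (z : ℂ) : ℂ := C.r z + C.t z * Complex.I

/-- The coefficient `Q = (p₁ - p₃) / 2 - i p₂` of the quartic differential. -/
def Q (z : ℂ) : ℂ := C.d z - C.p₂ z * Complex.I

lemma hasFDerivAt_ofReal_add_mul_I {f g : ℂ → ℝ} {f' g' : ℂ →L[ℝ] ℝ} (hf : HasFDerivAt f f' z)
    (hg : HasFDerivAt g g' z) : HasFDerivAt (fun z => (f z : ℂ) + g z * Complex.I)
      (Complex.ofRealCLM.comp f' + (Complex.I : ℂ) • Complex.ofRealCLM.comp g') z :=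
  (Complex.ofRealCLM.hasFDerivAt.comp z hf).add
    ((Complex.ofRealCLM.hasFDerivAt.comp z hg).mul_const Complex.I)

lemma μ_ne_zero (hz : z ∈ C.Ω) : C.μ z ≠ 0 := by
  intro h
  have h1 := congrArg Complex.re h
  have h2 := congrArg Complex.im h
  simp [μ] at h1 h2
  exact C.ne_zero z hz (by rw [h1, h2]; norm_num)

lemma hasFDerivAt_μ (hz : z ∈ C.Ω) : HasFDerivAt C.μ (Complex.ofRealCLM.comp (fderiv ℝ C.r z) +
    (Complex.I : ℂ) • Complex.ofRealCLM.comp (fderiv ℝ C.t z)) z :=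
  hasFDerivAt_ofReal_add_mul_I (C.diffAt C.smooth_r hz).hasFDerivAt
    (C.diffAt C.smooth_t hz).hasFDerivAt

lemma smooth_d : ContDiffOn ℝ ∞ C.d C.Ω := (C.smooth_p₁.sub C.smooth_p₃).div_const 2

lemma hasFDerivAt_Q (hz : z ∈ C.Ω) : HasFDerivAt C.Q (Complex.ofRealCLM.comp (fderiv ℝ C.d z) +
    (Complex.I : ℂ) • Complex.ofRealCLM.comp (-fderiv ℝ C.p₂ z)) z := by
  have h := hasFDerivAt_ofReal_add_mul_I (C.diffAt C.smooth_d hz).hasFDerivAt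
    (C.diffAt C.smooth_p₂ hz).hasFDerivAt.neg
  convert h using 2 with z
  simp [Q, sub_eq_add_neg]

/-- `dφ = (q₁ + i q₂) α² ∧ α³` in terms of `μ`. -/
lemma structure_μ (hz : z ∈ C.Ω) : fderiv ℝ C.μ z Complex.I - Complex.I * fderiv ℝ C.μ z 1 =
    -(C.q₁ z + C.q₂ z * Complex.I) * (C.r z - C.t z * Complex.I) * C.μ z := by
  rw [(C.hasFDerivAt_μ hz).fderiv, μ]
  have h1 := congrArg (fun x : ℝ => (x : ℂ)) (C.structure_α hz)
  have h2 := congrArg (fun x : ℝ => (x : ℂ)) (C.structure_β hz)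
  push_cast at h1 h2
  simp only [add_apply, smul_apply, ContinuousLinearMap.comp_apply, Complex.ofRealCLM_apply,
    smul_eq_mul]
  linear_combination h1 - Complex.I * h2 +
    (-fderiv ℝ C.t z 1 - C.q₁ z * C.t z ^ 2 - C.q₂ z * Complex.I * C.t z ^ 2) * Complex.I_sq

/-- The Cauchy–Riemann equation for the coefficient `Q μ⁴` of the quartic differential. -/
lemma fderiv_Q_of_holomorphic {h : ℂ → ℂ} (hz : z ∈ C.Ω) (hh : DifferentiableAt ℂ h z)
    (hQ : ∀ w ∈ C.Ω, C.Q w * C.μ w ^ 4 = h w) :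
    fderiv ℝ C.Q z Complex.I - Complex.I * fderiv ℝ C.Q z 1 =
      4 * C.Q z * (C.q₁ z + C.q₂ z * Complex.I) * (C.r z - C.t z * Complex.I) := by
  have hQd := (C.hasFDerivAt_Q hz).differentiableAt.hasFDerivAt
  have hμd := (C.hasFDerivAt_μ hz).differentiableAt.hasFDerivAt
  have h1 : fderiv ℝ h z Complex.I = Complex.I * fderiv ℝ h z 1 := by
    have := (hh.hasFDerivAt.restrictScalars ℝ).fderiv
    rw [this]
    simp only [ContinuousLinearMap.coe_restrictScalars']
    rw [← smul_eq_mul, ← map_smul, smul_eq_mul, mul_one]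
  rw [← fderiv_eq_of_eqOn C.isOpen hQ hz, (hQd.fun_mul (hμd.pow 4)).fderiv] at h1
  simp only [add_apply, smul_apply, smul_eq_mul] at h1
  have h2 := C.structure_μ hz
  have h3 := C.μ_ne_zero hz
  apply mul_right_cancel₀ (pow_ne_zero 4 h3)
  simp only [Nat.add_one_sub_one, nsmul_eq_mul] at h1
  push_cast at h1
  linear_combination h1 - 4 * C.Q z * C.μ z ^ 3 * h2

/-- If the quartic differential is holomorphic, the Codazzi equations reduce to `ds = -s τ`. -/
lemma fderiv_s_of_holomorphic {h : ℂ → ℂ} (hz : z ∈ C.Ω) (hh : DifferentiableAt ℂ h z)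
    (hQ : ∀ w ∈ C.Ω, C.Q w * C.μ w ^ 4 = h w) (v : ℂ) :
    fderiv ℝ C.s z v = -C.s z * C.τ z v := by
  have h0 := C.fderiv_Q_of_holomorphic hz hh hQ
  rw [(C.hasFDerivAt_Q hz).fderiv, Q] at h0
  simp only [add_apply, smul_apply, neg_apply, ContinuousLinearMap.comp_apply,
    Complex.ofRealCLM_apply, smul_eq_mul] at h0
  have hre := congrArg Complex.re h0
  have him := congrArg Complex.im h0
  simp [C.fderiv_d hz] at hre him
  have c1 := C.codazzi₁ hz
  have c2 := C.codazzi₂ hz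
  have hne := C.ne_zero z hz
  simp only [d] at hre him
  have hx : fderiv ℝ C.s z 1 = -C.s z * C.τ z 1 := by
    apply mul_right_cancel₀ hne
    simp only [C.fderiv_s hz, s, τ, Complex.one_re, Complex.one_im]
    linear_combination (-C.t z) * (c1 + C.r z * hre - C.t z * him) +
      C.r z * (c2 - C.t z * hre - C.r z * him)
  have hy : fderiv ℝ C.s z Complex.I = -C.s z * C.τ z Complex.I := by
    apply mul_right_cancel₀ hne
    simp only [C.fderiv_s hz, s, τ, Complex.I_re, Complex.I_im]
    linear_combination (-C.r z) * (c1 + C.r z * hre - C.t z * him) -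
      C.t z * (c2 - C.t z * hre - C.r z * him)
  rw [fderiv_apply_eq_re_im, hx, hy]
  simp only [τ, smul_eq_mul, Complex.one_re, Complex.one_im, Complex.I_re, Complex.I_im]
  ring

/-- The integrability condition of `ds = -s τ`, in view of `dτ = 2 p₂ α² ∧ α³`. -/
lemma p₂_eq_zero_of_fderiv_s (hs : ∀ z ∈ C.Ω, ∀ v, fderiv ℝ C.s z v = -C.s z * C.τ z v)
    (hz : z ∈ C.Ω) (hsz : C.s z ≠ 0) : C.p₂ z = 0 := by
  have h := fderiv_fderiv_comm C.isOpen C.smooth_s hz 1 Complex.I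
  have dn : DifferentiableAt ℝ (fun z => -C.s z) z := (C.diffAt C.smooth_s hz).neg
  rw [fderiv_eq_of_eqOn C.isOpen (fun w hw => hs w hw 1) hz,
    fderiv_eq_of_eqOn C.isOpen (fun w hw => hs w hw Complex.I) hz,
    fderiv_mul_apply dn (C.diffAt (C.smooth_τ 1) hz),
    fderiv_mul_apply dn (C.diffAt (C.smooth_τ Complex.I) hz),
    fderiv_neg_apply, fderiv_neg_apply, hs z hz, hs z hz] at h
  have h2 := C.structure_τ hz
  have h3 : C.s z * (C.r z ^ 2 + C.t z ^ 2) * C.p₂ z = 0 := by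
    linear_combination (1 / 2) * h - C.s z / 2 * h2
  exact (mul_eq_zero.1 h3).resolve_left (mul_ne_zero hsz (C.ne_zero z hz))

/-- When `p₂` vanishes, the Codazzi equations determine `d(p₁ - p₃)` from `d(p₁ + p₃)`. -/
lemma fderiv_d_of_p₂_eq_zero (hs : ∀ z ∈ C.Ω, ∀ v, fderiv ℝ C.s z v = -C.s z * C.τ z v)
    (hp : ∀ z ∈ C.Ω, C.p₂ z = 0) (hz : z ∈ C.Ω) (v : ℂ) :
    fderiv ℝ C.d z v = -2 * C.d z * C.τ z v := by
  have c1 := C.codazzi₁ hz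
  have c2 := C.codazzi₂ hz
  have hne := C.ne_zero z hz
  have hp' : fderiv ℝ C.p₂ z = 0 := by
    rw [fderiv_eq_of_eqOn C.isOpen hp hz]; simp
  have s1 := hs z hz 1
  have s2 := hs z hz Complex.I
  rw [C.fderiv_s hz] at s1 s2
  simp only [s, τ, Complex.one_re, Complex.one_im, Complex.I_re, Complex.I_im] at s1 s2
  rw [hp', hp z hz] at c1 c2
  simp only [zero_apply] at c1 c2
  have hx : fderiv ℝ C.d z 1 = -2 * C.d z * C.τ z 1 := by
    apply mul_right_cancel₀ hne
    simp only [C.fderiv_d hz, d, τ, Complex.one_re, Complex.one_im]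
    linear_combination (-C.t z) * c1 - C.r z * c2 + (C.r z ^ 2 - C.t z ^ 2) * s1 -
      2 * C.r z * C.t z * s2
  have hy : fderiv ℝ C.d z Complex.I = -2 * C.d z * C.τ z Complex.I := by
    apply mul_right_cancel₀ hne
    simp only [C.fderiv_d hz, d, τ, Complex.I_re, Complex.I_im]
    linear_combination (-C.r z) * c1 + C.t z * c2 - 2 * C.r z * C.t z * s1 -
      (C.r z ^ 2 - C.t z ^ 2) * s2
  rw [fderiv_apply_eq_re_im, hx, hy]
  simp only [τ, smul_eq_mul, Complex.one_re, Complex.one_im, Complex.I_re, Complex.I_im]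
  ring

end ConformalFrame

/-! ### Local constancy and local primitives -/

lemma eventually_eq_of_fderiv_eq_zero {E : Type*} [NormedAddCommGroup E] [NormedSpace ℝ E]
    {Ω : Set ℂ} (hΩ : IsOpen Ω) {f : ℂ → E} (hd : DifferentiableOn ℝ f Ω)
    (h : ∀ z ∈ Ω, ∀ v, fderiv ℝ f z v = 0) {z : ℂ} (hz : z ∈ Ω) : ∀ᶠ w in 𝓝 z, f w = f z := by
  obtain ⟨ε, hε, hB⟩ := Metric.isOpen_iff.1 hΩ z hz
  filter_upwards [Metric.ball_mem_nhds z hε] with w hw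
  exact Metric.isOpen_ball.is_const_of_fderiv_eq_zero (𝕜 := ℝ)
    (convex_ball z ε).isPreconnected (hd.mono hB)
    (fun x hx => ContinuousLinearMap.ext (h x (hB hx))) hw (Metric.mem_ball_self hε)

/-- A holomorphic function without zeros is locally the derivative of a coordinate. -/
lemma exists_coordinate_of_holomorphic {Ω : Set ℂ} (hΩ : IsOpen Ω) {g : ℂ → ℂ}
    (hg : DifferentiableOn ℂ g Ω) (h0 : ∀ z ∈ Ω, g z ≠ 0) {z₀ : ℂ} (hz₀ : z₀ ∈ Ω) :
    ∃ W : OpenPartialHomeomorph ℂ ℂ, z₀ ∈ W.source ∧ W.source ⊆ Ω ∧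
      ContDiffOn ℝ ∞ W W.source ∧ ContDiffOn ℝ ∞ W.symm W.target ∧
      ∀ z ∈ W.source, HasDerivAt W (g z) z := by
  obtain ⟨ε, hε, hB⟩ := Metric.isOpen_iff.1 hΩ z₀ hz₀
  obtain ⟨f, hf⟩ := (hg.mono hB).isExactOn_ball
  have hfd : DifferentiableOn ℂ f (Metric.ball z₀ ε) := fun z hz =>
    (hf z hz).differentiableAt.differentiableWithinAt
  have hfc : ContDiffOn ℂ ∞ f (Metric.ball z₀ ε) := hfd.contDiffOn Metric.isOpen_ball
  have hfa (z : ℂ) (hz : z ∈ Metric.ball z₀ ε) : ContDiffAt ℂ ∞ f z :=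
    hfc.contDiffAt (Metric.isOpen_ball.mem_nhds hz)
  have hz : z₀ ∈ Metric.ball z₀ ε := Metric.mem_ball_self hε
  have hd : HasFDerivAt f
      (ContinuousLinearEquiv.unitsEquivAut ℂ (Units.mk0 (g z₀) (h0 z₀ hz₀)) : ℂ →L[ℂ] ℂ) z₀ :=
    (hf z₀ hz).hasFDerivAt.congr_fderiv (by ext; simp)
  set W := (hfa z₀ hz).toOpenPartialHomeomorph f hd (by simp)
  have hW : (W : ℂ → ℂ) = f := rfl
  refine ⟨W.restrOpen _ Metric.isOpen_ball, ⟨?_, hz⟩, fun z h => hB h.2, ?_, ?_, ?_⟩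
  · exact (hfa z₀ hz).mem_toOpenPartialHomeomorph_source hd (by simp)
  · exact fun z h => ((hfa z h.2).restrict_scalars ℝ).contDiffWithinAt
  · intro w hw
    set W' := W.restrOpen _ Metric.isOpen_ball
    have hs : W'.symm w ∈ W'.source := W'.map_target hw
    have := W'.contDiffAt_symm_deriv (n := ∞) (h0 _ (hB hs.2)) hw (hf _ hs.2) (hfa _ hs.2)
    exact (this.restrict_scalars ℝ).contDiffWithinAt
  · exact fun z h => hf z h.2

namespace ConformalFrame

variable (C : ConformalFrame) {z : ℂ}

/-! ### Propagation of the zeros of `s` -/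

/-- By the uniqueness theorem for linear ordinary differential equations along rays, a zero of a
solution of `ds = -s τ` spreads to a neighborhood. -/
lemma eventually_s_eq_zero (hs : ∀ z ∈ C.Ω, ∀ v, fderiv ℝ C.s z v = -C.s z * C.τ z v)
    (hz : z ∈ C.Ω) (h0 : C.s z = 0) : ∀ᶠ w in 𝓝 z, C.s w = 0 := by
  obtain ⟨ε, hε, hB⟩ := Metric.isOpen_iff.1 C.isOpen z hz
  filter_upwards [Metric.ball_mem_nhds z hε] with w hw
  have hmem : ∀ x ∈ Set.Icc (0 : ℝ) 1, AffineMap.lineMap z w x ∈ C.Ω := fun x hx =>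
    hB ((convex_ball z ε).lineMap_mem (Metric.mem_ball_self hε) hw hx)
  have hl (x : ℝ) : HasDerivAt (AffineMap.lineMap z w : ℝ → ℂ) (w - z) x :=
    AffineMap.hasDerivAt_lineMap
  have hd : ∀ x ∈ Set.Icc (0 : ℝ) 1, HasDerivAt (fun x : ℝ => C.s (AffineMap.lineMap z w x))
      (-C.s (AffineMap.lineMap z w x) * C.τ (AffineMap.lineMap z w x) (w - z)) x := by
    intro x hx
    rw [← hs _ (hmem x hx)]
    exact (C.diffAt C.smooth_s (hmem x hx)).hasFDerivAt.comp_hasDerivAt x (hl x)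
  have hc : ContinuousOn (fun x : ℝ => C.τ (AffineMap.lineMap z w x) (w - z))
      (Set.Icc (0 : ℝ) 1) :=
    (C.smooth_τ (w - z)).continuousOn.comp (AffineMap.lineMap_continuous.continuousOn) hmem
  obtain ⟨K, hK⟩ := isCompact_Icc.exists_bound_of_continuousOn hc
  have := eq_zero_of_abs_deriv_le_mul_abs_self_of_eq_zero_right (K := K)
    (fun x hx => (hd x hx).continuousAt.continuousWithinAt)
    (fun x hx => (hd x (Set.Ico_subset_Icc_self hx)).hasDerivWithinAt)
    (by simpa using h0) (fun x hx => by
      rw [norm_mul, norm_neg, mul_comm]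
      exact mul_le_mul_of_nonneg_right (hK x (Set.Ico_subset_Icc_self hx)) (norm_nonneg _))
    1 (Set.right_mem_Icc.2 zero_le_one)
  simpa using this

/-! ### The center of the L-Gauss map -/

/-- If `u`, `v` satisfy `du = -u τ` and `dv = v τ`, and `a₀ = O + u a₁ + v a₄` is compatible with
the first-order structure equations, then `O` is constant. -/
lemma fderiv_center {u v : ℂ → ℝ} (hz : z ∈ C.Ω) (hu : DifferentiableAt ℝ u z)
    (hv : DifferentiableAt ℝ v z) (h1 : u z + v z * C.p₁ z = 1) (h2 : v z * C.p₂ z = 0)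
    (h3 : -u z + v z * C.p₃ z = 1) {w : ℂ} (hu' : fderiv ℝ u z w = -u z * C.τ z w)
    (hv' : fderiv ℝ v z w = v z * C.τ z w) :
    fderiv ℝ (fun z => C.a₀ z - u z • C.e₁ z - v z • C.e₄ z) z w = 0 := by
  have h := (((C.diffAt C.smooth_a₀ hz).hasFDerivAt.sub
    (hu.hasFDerivAt.smul (C.diffAt C.smooth_e₁ hz).hasFDerivAt)).sub
      (hv.hasFDerivAt.smul (C.diffAt C.smooth_e₄ hz).hasFDerivAt)).fderiv
  refine (congrArg (fun L => L w) h).trans ?_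
  simp only [sub_apply, add_apply, smul_apply, ContinuousLinearMap.smulRight_apply,
    C.fderiv_a₀ z hz, C.fderiv_e₁ z hz, C.fderiv_e₄ z hz, hu', hv', τ]
  set α := C.r z * w.re - C.t z * w.im
  set β := C.t z * w.re + C.r z * w.im
  linear_combination (norm := module) (-α * h1 - β * h2) • C.e₂ z + (-β * h3 - α * h2) • C.e₃ z

/-- The center of the quadric that carries the L-Gauss map. -/
def center (z : ℂ) : Mink :=
  C.a₀ z - (-(C.d z / C.s z)) • C.e₁ z - (1 / C.s z) • C.e₄ z

lemma fderiv_inv_s (hs : ∀ z ∈ C.Ω, ∀ v, fderiv ℝ C.s z v = -C.s z * C.τ z v)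
    (hs0 : ∀ z ∈ C.Ω, C.s z ≠ 0) (hz : z ∈ C.Ω) (v : ℂ) :
    fderiv ℝ (fun z => 1 / C.s z) z v = 1 / C.s z * C.τ z v := by
  have hsz := hs0 z hz
  have h := ((hasDerivAt_inv hsz).comp_hasFDerivAt z (C.diffAt C.smooth_s hz).hasFDerivAt).fderiv
  simp only [one_div]
  refine (congrArg (fun L => L v) h).trans ?_
  simp only [smul_apply, smul_eq_mul, hs z hz]
  field_simp

lemma differentiableAt_inv_s (hs0 : ∀ z ∈ C.Ω, C.s z ≠ 0) (hz : z ∈ C.Ω) :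
    DifferentiableAt ℝ (fun z => 1 / C.s z) z := by
  simp only [one_div]
  exact ((hasDerivAt_inv (hs0 z hz)).comp_hasFDerivAt z
    (C.diffAt C.smooth_s hz).hasFDerivAt).differentiableAt

lemma differentiableAt_center (hs0 : ∀ z ∈ C.Ω, C.s z ≠ 0) (hz : z ∈ C.Ω) :
    DifferentiableAt ℝ C.center z := by
  have h1 := C.diffAt C.smooth_a₀ hz
  have h2 := C.diffAt C.smooth_e₁ hz
  have h3 := C.diffAt C.smooth_e₄ hz
  have h4 := C.differentiableAt_inv_s hs0 hz
  have h5 : DifferentiableAt ℝ (fun z => -(C.d z / C.s z)) z := by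
    simp only [div_eq_mul_one_div (C.d _)]
    exact ((C.diffAt C.smooth_d hz).fun_mul h4).fun_neg
  exact (h1.fun_sub (h5.fun_smul h2)).fun_sub (h4.fun_smul h3)

lemma fderiv_center_eq_zero (hs : ∀ z ∈ C.Ω, ∀ v, fderiv ℝ C.s z v = -C.s z * C.τ z v)
    (hs0 : ∀ z ∈ C.Ω, C.s z ≠ 0) (hz : z ∈ C.Ω) (w : ℂ) : fderiv ℝ C.center z w = 0 := by
  have hp : ∀ z ∈ C.Ω, C.p₂ z = 0 := fun z hz => C.p₂_eq_zero_of_fderiv_s hs hz (hs0 z hz)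
  have hsz := hs0 z hz
  have hd := C.diffAt C.smooth_d hz
  have hi := C.differentiableAt_inv_s hs0 hz
  have e : (fun z => -(C.d z / C.s z)) = fun z => -(C.d z * (1 / C.s z)) := by
    ext z; ring
  refine C.fderiv_center hz ?_ hi ?_ ?_ ?_ ?_ ?_
  · rw [e]; exact (hd.fun_mul hi).fun_neg
  · rw [show C.p₁ z = C.s z + C.d z by rw [s, d]; ring]
    field_simp; ring
  · rw [hp z hz, mul_zero]
  · rw [show C.p₃ z = C.s z - C.d z by rw [s, d]; ring]
    field_simp; ring
  · rw [e, fderiv_neg_apply, fderiv_mul_apply hd hi, C.fderiv_inv_s hs hs0 hz,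
      C.fderiv_d_of_p₂_eq_zero hs hp hz]
    ring
  · rw [C.fderiv_inv_s hs hs0 hz]

lemma fderiv_lor_sub_center (hs : ∀ z ∈ C.Ω, ∀ v, fderiv ℝ C.s z v = -C.s z * C.τ z v)
    (hs0 : ∀ z ∈ C.Ω, C.s z ≠ 0) (hz : z ∈ C.Ω) (w : ℂ) :
    fderiv ℝ (fun z => lor (C.a₀ z - C.center z) (C.a₀ z - C.center z)) z w = 0 := by
  have h1 := C.diffAt C.smooth_a₀ hz
  have h2 := C.differentiableAt_center hs0 hz
  have h3 : fderiv ℝ (fun z => C.a₀ z - C.center z) z w = fderiv ℝ C.a₀ z w := by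
    rw [fderiv_fun_sub h1 h2, sub_apply, C.fderiv_center_eq_zero hs hs0 hz, sub_zero]
  have h4 : C.a₀ z - C.center z = (-(C.d z / C.s z)) • C.e₁ z + (1 / C.s z) • C.e₄ z := by
    rw [center]; abel
  have e := C.isNullBasis z hz
  rw [fderiv_lor_apply (h1.fun_sub h2) (h1.fun_sub h2), h3, h4, C.fderiv_a₀ z hz]
  simp only [lor_add_left, lor_add_right, lor_smul_left, lor_smul_right, e.e12, e.e13, e.e42,
    e.e43, e.e21, e.e31, e.e24, e.e34]
  ring

/-! ### Isothermic coordinates -/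

/-- The form `|s|^{1/2} φ` is closed: in a conformal coordinate it is `g dz` with `g`
holomorphic. The factor is written `exp (log s / 2)`, where `log s = log |s|` for either sign
of `s`. -/
lemma differentiableAt_exp_mul_μ (hs : ∀ z ∈ C.Ω, ∀ v, fderiv ℝ C.s z v = -C.s z * C.τ z v)
    (hs0 : ∀ z ∈ C.Ω, C.s z ≠ 0) (hz : z ∈ C.Ω) :
    DifferentiableAt ℂ (fun z => (Real.exp (Real.log (C.s z) / 2) : ℂ) * C.μ z) z := by
  have hsz := hs0 z hz
  set ρ : ℂ → ℝ := fun z => Real.exp (Real.log (C.s z) / 2)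
  have hl := (((C.diffAt C.smooth_s hz).hasFDerivAt.log hsz).mul_const (2 : ℝ)⁻¹).exp
  have hρ : DifferentiableAt ℝ ρ z := hl.differentiableAt
  have hρ' (v : ℂ) : fderiv ℝ ρ z v = -ρ z * C.τ z v / 2 := by
    refine (congrArg (fun L => L v) hl.fderiv).trans ?_
    simp only [smul_apply, smul_eq_mul, hs z hz, ρ, div_eq_mul_inv]
    field_simp
  have hl' : HasFDerivAt (fun z => (ρ z : ℂ)) (Complex.ofRealCLM.comp (fderiv ℝ ρ z)) z :=
    Complex.ofRealCLM.hasFDerivAt.comp z hρ.hasFDerivAt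
  have hμ := (C.hasFDerivAt_μ hz).differentiableAt.hasFDerivAt
  rw [differentiableAt_complex_iff_differentiableAt_real]
  refine ⟨(hl'.fun_mul hμ).differentiableAt, ?_⟩
  rw [(hl'.fun_mul hμ).fderiv]
  have h2 := C.structure_μ hz
  simp only [add_apply, smul_apply, smul_eq_mul, ContinuousLinearMap.comp_apply,
    Complex.ofRealCLM_apply, hρ', τ, Complex.one_re, Complex.one_im, Complex.I_re, Complex.I_im]
  push_cast
  linear_combination (ρ z : ℂ) * h2 +
    (ρ z : ℂ) * C.μ z * C.q₂ z * C.t z * Complex.I_sq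

/-! ### L-Gauss maps into a quadric -/

/-- In a coordinate with `φ = r dz`, `r` real, an L-Gauss map with values in a quadric has a
quartic differential with constant coefficient. -/
lemma quartic_of_lor_sub_eq_const {O : Mink} {c : ℝ}
    (hc : ∀ z ∈ C.Ω, lor (C.a₀ z - O) (C.a₀ z - O) = c) (ht : ∀ z ∈ C.Ω, C.t z = 0) :
    (∀ z ∈ C.Ω, C.p₂ z = 0) ∧ (∀ z ∈ C.Ω, C.s z ≠ 0) ∧
      ∀ z ∈ C.Ω, ∀ w, fderiv ℝ (fun z => C.d z * C.r z ^ 4) z w = 0 := by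
  have hO (z : ℂ) (hz : z ∈ C.Ω) : DifferentiableAt ℝ (fun z => C.a₀ z - O) z :=
    (C.diffAt C.smooth_a₀ hz).sub_const O
  have hOd (z : ℂ) (hz : z ∈ C.Ω) (w : ℂ) : fderiv ℝ (fun z => C.a₀ z - O) z w =
      fderiv ℝ C.a₀ z w := by rw [fderiv_sub_const]
  have hr (z : ℂ) (hz : z ∈ C.Ω) : C.r z ≠ 0 := fun h => C.ne_zero z hz (by
    rw [h, ht z hz]; ring)
  -- `⟨a₀ - O, a₀ - O⟩` is constant, so `a₀ - O` is orthogonal to the image of `da₀`.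
  have h23 (z : ℂ) (hz : z ∈ C.Ω) :
      lor (C.a₀ z - O) (C.e₂ z) = 0 ∧ lor (C.a₀ z - O) (C.e₃ z) = 0 := by
    have key (w : ℂ) : lor (C.a₀ z - O) (fderiv ℝ C.a₀ z w) = 0 := by
      have h := congrArg (fun L => L w) (fderiv_eq_of_eqOn C.isOpen hc hz)
      simp only [fderiv_fun_const, Pi.zero_apply, zero_apply] at h
      rw [fderiv_lor_apply (hO z hz) (hO z hz), hOd z hz, lor_comm] at h
      linarith
    have k1 := key 1
    have k2 := key Complex.I
    rw [C.fderiv_a₀ z hz, ht z hz] at k1 k2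
    simp only [Complex.one_re, Complex.one_im, Complex.I_re, Complex.I_im, lor_add_right,
      lor_smul_right, mul_zero, mul_one, sub_zero, add_zero, zero_mul, zero_add] at k1 k2
    exact ⟨(mul_eq_zero.1 k1).resolve_left (hr z hz), (mul_eq_zero.1 k2).resolve_left (hr z hz)⟩
  set u : ℂ → ℝ := fun z => -lor (C.a₀ z - O) (C.e₄ z) with hu
  set v : ℂ → ℝ := fun z => -lor (C.a₀ z - O) (C.e₁ z) with hv
  have hvd (z : ℂ) (hz : z ∈ C.Ω) : DifferentiableAt ℝ v z :=
    (differentiableAt_lor (hO z hz) (C.diffAt C.smooth_e₁ hz)).fun_neg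
  have hu' (z : ℂ) (hz : z ∈ C.Ω) (w : ℂ) : fderiv ℝ u z w = -u z * C.τ z w := by
    have e := C.isNullBasis z hz
    rw [hu, fderiv_neg_apply, fderiv_lor_apply (hO z hz) (C.diffAt C.smooth_e₄ hz), hOd z hz,
      C.fderiv_a₀ z hz, C.fderiv_e₄ z hz]
    simp only [lor_add_left, lor_smul_left, lor_add_right, lor_sub_right, lor_smul_right,
      (h23 z hz).1, (h23 z hz).2, e.e24, e.e34, τ]
    ring
  have hv' (z : ℂ) (hz : z ∈ C.Ω) (w : ℂ) : fderiv ℝ v z w = v z * C.τ z w := by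
    have e := C.isNullBasis z hz
    rw [hv, fderiv_neg_apply, fderiv_lor_apply (hO z hz) (C.diffAt C.smooth_e₁ hz), hOd z hz,
      C.fderiv_a₀ z hz, C.fderiv_e₁ z hz]
    simp only [lor_add_left, lor_smul_left, lor_add_right, lor_sub_right, lor_smul_right,
      (h23 z hz).1, (h23 z hz).2, e.e21, e.e31, τ]
    ring
  have h2 (z : ℂ) (hz : z ∈ C.Ω) : u z + v z * C.p₁ z = 1 ∧ v z * C.p₂ z = 0 := by
    have e := C.isNullBasis z hz
    have key (w : ℂ) : (C.r z * w.re) * (1 - u z - v z * C.p₁ z) -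
        (C.r z * w.im) * (v z * C.p₂ z) = 0 := by
      have h := congrArg (fun L => L w) (fderiv_eq_of_eqOn C.isOpen (fun z hz => (h23 z hz).1) hz)
      simp only [fderiv_fun_const, Pi.zero_apply, zero_apply] at h
      rw [fderiv_lor_apply (hO z hz) (C.diffAt C.smooth_e₂ hz), hOd z hz,
        C.fderiv_a₀ z hz, C.fderiv_e₂ z hz] at h
      simp only [lor_add_left, lor_smul_left, lor_add_right, lor_smul_right,
        (h23 z hz).2, e.e22, e.e32, ht z hz] at h
      simp only [hu, hv]
      linear_combination h
    have k1 := key 1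
    have k2 := key Complex.I
    simp only [Complex.one_re, Complex.one_im, Complex.I_re, Complex.I_im, mul_zero, mul_one,
      zero_mul, sub_zero, zero_sub, neg_eq_zero] at k1 k2
    have l1 := (mul_eq_zero.1 k1).resolve_left (hr z hz)
    exact ⟨by linarith, (mul_eq_zero.1 k2).resolve_left (hr z hz)⟩
  have h3 (z : ℂ) (hz : z ∈ C.Ω) : -u z + v z * C.p₃ z = 1 := by
    have e := C.isNullBasis z hz
    have h := congrArg (fun L => L Complex.I)
      (fderiv_eq_of_eqOn C.isOpen (fun z hz => (h23 z hz).2) hz)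
    simp only [fderiv_fun_const, Pi.zero_apply, zero_apply] at h
    rw [fderiv_lor_apply (hO z hz) (C.diffAt C.smooth_e₃ hz), hOd z hz,
      C.fderiv_a₀ z hz, C.fderiv_e₃ z hz] at h
    simp only [lor_add_left, lor_smul_left, lor_sub_right, lor_smul_right,
      (h23 z hz).1, e.e23, e.e33, ht z hz, Complex.I_re, Complex.I_im] at h
    have k : C.r z * (1 + u z - v z * C.p₃ z) = 0 := by
      simp only [hu, hv]
      linear_combination h
    linarith [(mul_eq_zero.1 k).resolve_left (hr z hz)]
  have hsv (z : ℂ) (hz : z ∈ C.Ω) : v z * C.s z = 1 := by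
    rw [s]; linarith [(h2 z hz).1, h3 z hz]
  have hdu (z : ℂ) (hz : z ∈ C.Ω) : v z * C.d z = -u z := by
    rw [d]; linarith [(h2 z hz).1, h3 z hz]
  have hv0 (z : ℂ) (hz : z ∈ C.Ω) : v z ≠ 0 := left_ne_zero_of_mul_eq_one (hsv z hz)
  refine ⟨fun z hz => (mul_eq_zero.1 (h2 z hz).2).resolve_left (hv0 z hz),
    fun z hz => right_ne_zero_of_mul_eq_one (hsv z hz), fun z hz w => ?_⟩
  have hdd := C.diffAt C.smooth_d hz
  have hrd := C.diffAt C.smooth_r hz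
  have hd' : fderiv ℝ C.d z w = -2 * C.d z * C.τ z w := by
    have h := congrArg (fun L => L w) (fderiv_eq_of_eqOn C.isOpen hdu hz)
    simp only [fderiv_neg_apply] at h
    rw [fderiv_mul_apply (hvd z hz) hdd, hv' z hz, hu' z hz] at h
    apply mul_left_cancel₀ (hv0 z hz)
    linear_combination h + C.τ z w * hdu z hz
  have ht' : fderiv ℝ C.t z = 0 := by
    rw [fderiv_eq_of_eqOn C.isOpen ht hz]; simp
  have hr' : fderiv ℝ C.r z w = C.r z * C.τ z w / 2 := by
    have k1 := C.structure_α hz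
    have k2 := C.structure_β hz
    rw [ht', ht z hz] at k1 k2
    simp only [zero_apply] at k1 k2
    rw [fderiv_apply_eq_re_im, τ, ht z hz, smul_eq_mul, smul_eq_mul]
    linear_combination w.im * k1 + w.re * k2
  have hp := ((hdd.hasFDerivAt).fun_mul (hrd.hasFDerivAt.pow 4)).fderiv
  refine (congrArg (fun L => L w) hp).trans ?_
  simp only [add_apply, smul_apply, smul_eq_mul, hd', hr']
  simp
  ring

end ConformalFrame

/-! ### Isothermic coordinates are conformal up to orientation -/

/-- If two linear forms `α = α₁ dx + α₂ dy`, `β = β₁ dx + β₂ dy` depend continuously on a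
parameter and `α² + β²`, `α² - β²` are diagonal, the first one a multiple of `dx² + dy²`, then
locally `α` and `β` change only by a common factor. -/
lemma eventually_exists_factor {S : Type*} [TopologicalSpace S] {α₁ α₂ β₁ β₂ : S → ℝ} {p : S}
    (h1 : ContinuousAt α₁ p) (h2 : ContinuousAt α₂ p) (h3 : ContinuousAt β₁ p)
    (h4 : ContinuousAt β₂ p)
    (h : ∀ᶠ q in 𝓝 p, ∃ E a b : ℝ, 0 < E ∧ ∀ x y : ℝ,
      (α₁ q * x + α₂ q * y) ^ 2 + (β₁ q * x + β₂ q * y) ^ 2 = E * (x ^ 2 + y ^ 2) ∧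
      (α₁ q * x + α₂ q * y) ^ 2 - (β₁ q * x + β₂ q * y) ^ 2 = a * x ^ 2 + b * y ^ 2) :
    ∀ᶠ q in 𝓝 p, ∃ k : ℝ, α₁ q = k * α₁ p ∧ α₂ q = k * α₂ p ∧ β₁ q = k * β₁ p ∧
      β₂ q = k * β₂ p := by
  have key : ∀ᶠ q in 𝓝 p, α₁ q * α₂ q = 0 ∧ β₁ q * β₂ q = 0 ∧
      α₁ q ^ 2 + β₁ q ^ 2 = α₂ q ^ 2 + β₂ q ^ 2 ∧ 0 < α₁ q ^ 2 + β₁ q ^ 2 := by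
    filter_upwards [h] with q ⟨E, a, b, hE, hq⟩
    have k1 := hq 1 0
    have k2 := hq 0 1
    have k3 := hq 1 1
    refine ⟨?_, ?_, ?_, ?_⟩ <;> linarith [k1.1, k1.2, k2.1, k2.2, k3.1, k3.2]
  obtain ⟨p1, p2, p3, p4⟩ := key.self_of_nhds
  by_cases hα : α₁ p = 0
  · have hβ : β₁ p ≠ 0 := fun hb => by rw [hα, hb] at p4; norm_num at p4
    have hβ2 : β₂ p = 0 := (mul_eq_zero.1 p2).resolve_left hβ
    have hα2 : α₂ p ≠ 0 := fun hb => by rw [hβ2, hb] at p3; linarith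
    have c1 : ∀ᶠ q in 𝓝 p, 0 < β₁ q * β₁ p :=
      (h3.mul continuousAt_const).eventually (lt_mem_nhds (mul_self_pos.2 hβ))
    have c2 : ∀ᶠ q in 𝓝 p, 0 < α₂ q * α₂ p :=
      (h2.mul continuousAt_const).eventually (lt_mem_nhds (mul_self_pos.2 hα2))
    filter_upwards [key, c1, c2] with q ⟨q1, q2, q3, q4⟩ d1 d2
    have hβq : β₁ q ≠ 0 := left_ne_zero_of_mul d1.ne'
    have hαq : α₂ q ≠ 0 := left_ne_zero_of_mul d2.ne'
    have e1 : β₂ q = 0 := (mul_eq_zero.1 q2).resolve_left hβq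
    have e2 : α₁ q = 0 := (mul_eq_zero.1 q1).resolve_right hαq
    rw [hα, hβ2] at p3
    rw [e1, e2] at q3
    refine ⟨β₁ q / β₁ p, by rw [hα, e2, mul_zero], ?_,
      by field_simp, by rw [hβ2, e1, mul_zero]⟩
    rw [eq_comm, div_mul_eq_mul_div, div_eq_iff hβ]
    have hsq : (β₁ q * α₂ p) ^ 2 = (α₂ q * β₁ p) ^ 2 := by
      linear_combination α₂ p ^ 2 * q3 - α₂ q ^ 2 * p3
    rcases sq_eq_sq_iff_eq_or_eq_neg.1 hsq with hh | hh
    · exact hh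
    · exfalso
      have : (β₁ q * β₁ p) * (α₂ q * α₂ p) = -(α₂ q * β₁ p) ^ 2 := by
        linear_combination (β₁ p * α₂ q) * hh
      nlinarith [mul_pos d1 d2, sq_nonneg (α₂ q * β₁ p)]
  · have hα2 : α₂ p = 0 := (mul_eq_zero.1 p1).resolve_left hα
    have hβ2 : β₂ p ≠ 0 := fun hb => by rw [hα2, hb] at p3; linarith
    have hβ : β₁ p = 0 := (mul_eq_zero.1 p2).resolve_right hβ2
    have c1 : ∀ᶠ q in 𝓝 p, 0 < α₁ q * α₁ p :=
      (h1.mul continuousAt_const).eventually (lt_mem_nhds (mul_self_pos.2 hα))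
    have c2 : ∀ᶠ q in 𝓝 p, 0 < β₂ q * β₂ p :=
      (h4.mul continuousAt_const).eventually (lt_mem_nhds (mul_self_pos.2 hβ2))
    filter_upwards [key, c1, c2] with q ⟨q1, q2, q3, q4⟩ d1 d2
    have hαq : α₁ q ≠ 0 := left_ne_zero_of_mul d1.ne'
    have hβq : β₂ q ≠ 0 := left_ne_zero_of_mul d2.ne'
    have e1 : β₁ q = 0 := (mul_eq_zero.1 q2).resolve_right hβq
    have e2 : α₂ q = 0 := (mul_eq_zero.1 q1).resolve_left hαq
    rw [hα2, hβ] at p3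
    rw [e1, e2] at q3
    refine ⟨α₁ q / α₁ p, by field_simp, by rw [hα2, e2, mul_zero],
      by rw [hβ, e1, mul_zero], ?_⟩
    rw [eq_comm, div_mul_eq_mul_div, div_eq_iff hα]
    have hsq : (α₁ q * β₂ p) ^ 2 = (β₂ q * α₁ p) ^ 2 := by
      linear_combination β₂ p ^ 2 * q3 - β₂ q ^ 2 * p3
    rcases sq_eq_sq_iff_eq_or_eq_neg.1 hsq with hh | hh
    · exact hh
    · exfalso
      have : (α₁ q * α₁ p) * (β₂ q * β₂ p) = -(β₂ q * α₁ p) ^ 2 := by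
        linear_combination (α₁ p * β₂ q) * hh
      nlinarith [mul_pos d1 d2, sq_nonneg (β₂ q * α₁ p)]

section

variable {M : Type*} [TopologicalSpace M] [ChartedSpace (EuclideanSpace ℝ (Fin 2)) M]
variable {F : LegendreImmersion M}

/-! ### Smooth coordinates -/

namespace IsSmoothCoordinate

variable {z : OpenPartialHomeomorph M ℂ}

lemma mdifferentiableAt (hz : IsSmoothCoordinate z) {q : M} (hq : q ∈ z.source) :
    MDifferentiableAt (𝓡 2) 𝓘(ℝ, ℂ) z q :=
  (hz.1.contMDiffAt (z.open_source.mem_nhds hq)).mdifferentiableAt (by simp)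

lemma mdifferentiableAt_symm (hz : IsSmoothCoordinate z) {w : ℂ} (hw : w ∈ z.target) :
    MDifferentiableAt 𝓘(ℝ, ℂ) (𝓡 2) z.symm w :=
  (hz.2.contMDiffAt (z.open_target.mem_nhds hw)).mdifferentiableAt (by simp)

lemma contDiffOn_comp_symm {E : Type*} [NormedAddCommGroup E] [NormedSpace ℝ E]
    (hz : IsSmoothCoordinate z) {g : M → E} {s : Set M} (hg : ContMDiffOn (𝓡 2) 𝓘(ℝ, E) ∞ g s)
    (hs : z.source ⊆ s) : ContDiffOn ℝ ∞ (fun w => g (z.symm w)) z.target :=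
  (hg.comp hz.2 fun _ hw => hs (z.map_target hw)).contDiffOn

/-- A differential, computed in a coordinate. -/
lemma fderiv_comp_symm {E : Type*} [NormedAddCommGroup E] [NormedSpace ℝ E]
    (hz : IsSmoothCoordinate z) {q : M} (hq : q ∈ z.source) {g : M → E}
    (hg : DifferentiableAt ℝ (fun w => g (z.symm w)) (z q)) (X : TangentSpace (𝓡 2) q) :
    fderiv ℝ (fun w => g (z.symm w)) (z q) (diff z q X) = diff g q X := by
  rw [← diff_comp hg.hasFDerivAt (hz.mdifferentiableAt hq)]
  apply diff_congr
  filter_upwards [z.open_source.mem_nhds hq] with x hx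
  rw [z.left_inv hx]

lemma exists_diff_eq (hz : IsSmoothCoordinate z) {q : M} (hq : q ∈ z.source) (v : ℂ) :
    ∃ X : TangentSpace (𝓡 2) q, diff z q X = v := by
  have hw : z q ∈ z.target := z.map_source hq
  have hs := (hz.mdifferentiableAt_symm hw).hasMFDerivAt
  have hd : HasMFDerivAt (𝓡 2) 𝓘(ℝ, ℂ) z (z.symm (z q)) (mfderiv (𝓡 2) 𝓘(ℝ, ℂ) z (z.symm (z q))) :=
    (hz.mdifferentiableAt (z.map_target hw)).hasMFDerivAt
  have hc := (HasMFDerivAt.comp (z q) hd hs).mfderiv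
  have hid : mfderiv 𝓘(ℝ, ℂ) 𝓘(ℝ, ℂ) (z ∘ z.symm) (z q) =
      mfderiv 𝓘(ℝ, ℂ) 𝓘(ℝ, ℂ) id (z q) := by
    apply Filter.EventuallyEq.mfderiv_eq
    filter_upwards [z.open_target.mem_nhds hw] with x hx
    exact z.right_inv hx
  rw [hid, mfderiv_id] at hc
  have hv := congrArg (fun L => L v) hc
  have hex : ∃ X : TangentSpace (𝓡 2) (z.symm (z q)), diff z (z.symm (z q)) X = v :=
    ⟨_, hv.symm⟩
  rwa [z.left_inv hq] at hex

lemma restrOpen (hz : IsSmoothCoordinate z) {s : Set M} (hs : IsOpen s) :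
    IsSmoothCoordinate (z.restrOpen s hs) :=
  ⟨hz.1.mono fun _ h => h.1, hz.2.mono fun _ h => h.1⟩

lemma trans (hz : IsSmoothCoordinate z) {W : OpenPartialHomeomorph ℂ ℂ}
    (h1 : ContDiffOn ℝ ∞ W W.source) (h2 : ContDiffOn ℝ ∞ W.symm W.target) :
    IsSmoothCoordinate (z ≫ₕ W) :=
  ⟨h1.contMDiffOn.comp (hz.1.mono fun _ h => h.1) fun _ h => h.2,
    hz.2.comp (h2.contMDiffOn.mono fun _ h => h.1) fun _ h => h.2⟩

lemma diff_trans (hz : IsSmoothCoordinate z) {W : ℂ → ℂ} {W' : ℂ →L[ℝ] ℂ} {q : M}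
    (hq : q ∈ z.source) (hW : HasFDerivAt W W' (z q)) (X : TangentSpace (𝓡 2) q) :
    diff (fun x => W (z x)) q X = W' (diff z q X) :=
  diff_comp hW (hz.mdifferentiableAt hq) X

end IsSmoothCoordinate

/-! ### Middle frames in coordinates -/

namespace MiddleFrameField

lemma contDiffOn_lor {Ω : Set ℂ} {f g : ℂ → Mink} (hf : ContDiffOn ℝ ∞ f Ω)
    (hg : ContDiffOn ℝ ∞ g Ω) : ContDiffOn ℝ ∞ (fun z => lor (f z) (g z)) Ω :=
  (lorL.contDiff.comp_contDiffOn hf).clm_apply hg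

section

variable (A : MiddleFrameField F) {z : OpenPartialHomeomorph M ℂ} {w : ℂ}

lemma fderiv_comp_symm {E : Type*} [NormedAddCommGroup E] [NormedSpace ℝ E] {g : M → E}
    (hz : IsSmoothCoordinate z) (hA : z.source ⊆ A.domain) (hw : w ∈ z.target)
    (hg : ContMDiffOn (𝓡 2) 𝓘(ℝ, E) ∞ g A.domain) {X : TangentSpace (𝓡 2) (z.symm w)} {v : ℂ}
    (hX : diff z (z.symm w) X = v) :
    fderiv ℝ (fun w => g (z.symm w)) w v = diff g (z.symm w) X := by
  have hd := differentiableAt_of_smoothOn z.open_target (hz.contDiffOn_comp_symm hg hA) hw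
  rw [← z.right_inv hw] at hd
  have := hz.fderiv_comp_symm (z.map_target hw) hd X
  rwa [z.right_inv hw, hX] at this

lemma exists_tangent (hz : IsSmoothCoordinate z) (hA : z.source ⊆ A.domain)
    (hφ : ∀ q ∈ z.source, ∃ c : ℂ, ∀ X, A.φ q X = c * diff z q X) (hw : w ∈ z.target) (v : ℂ) :
    ∃ X : TangentSpace (𝓡 2) (z.symm w), diff z (z.symm w) X = v ∧
      A.φ (z.symm w) X = (lor (fderiv ℝ (fun w => A.a₀ (z.symm w)) w 1) (A.a 1 (z.symm w)) +
        lor (fderiv ℝ (fun w => A.a₀ (z.symm w)) w 1) (A.a 2 (z.symm w)) * Complex.I) * v := by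
  have hq := z.map_target hw
  obtain ⟨c, hc⟩ := hφ _ hq
  obtain ⟨X, hX⟩ := hz.exists_diff_eq hq v
  obtain ⟨Y, hY⟩ := hz.exists_diff_eq hq 1
  refine ⟨X, hX, ?_⟩
  rw [A.fderiv_comp_symm hz hA hw A.smooth_a₀ hY, A.lor_diff_a₀_one Y (hA hq),
    A.lor_diff_a₀_two Y (hA hq), hc, hX]
  have h1 := hc Y
  rw [hY, mul_one, FrameField.φ] at h1
  rw [← h1]
  ring

/-- The values of `α²` and `α³` on the tangent vector with coordinate expression `v`. -/
lemma exists_tangent_θ (hz : IsSmoothCoordinate z) (hA : z.source ⊆ A.domain)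
    (hφ : ∀ q ∈ z.source, ∃ c : ℂ, ∀ X, A.φ q X = c * diff z q X) (hw : w ∈ z.target) (v : ℂ) :
    ∃ X : TangentSpace (𝓡 2) (z.symm w), diff z (z.symm w) X = v ∧
      A.θ₂ (z.symm w) X =
        lor (fderiv ℝ (fun w => A.a₀ (z.symm w)) w 1) (A.a 1 (z.symm w)) * v.re -
        lor (fderiv ℝ (fun w => A.a₀ (z.symm w)) w 1) (A.a 2 (z.symm w)) * v.im ∧
      A.θ₃ (z.symm w) X =
        lor (fderiv ℝ (fun w => A.a₀ (z.symm w)) w 1) (A.a 2 (z.symm w)) * v.re +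
        lor (fderiv ℝ (fun w => A.a₀ (z.symm w)) w 1) (A.a 1 (z.symm w)) * v.im := by
  obtain ⟨X, hX, h⟩ := A.exists_tangent hz hA hφ hw v
  refine ⟨X, hX, ?_, ?_⟩
  · rw [← re_φ, h]
    simp
  · rw [← im_φ, h]
    simp
    ring

end

/-- A middle frame in a coordinate `z` for which `φ` is of type `(1, 0)`. The coefficient `r + i t`
of `φ` is the value of `φ` on the first coordinate vector field, written as
`⟨∂ₓa₀, a₂⟩ + i ⟨∂ₓa₀, a₃⟩`. -/
def conformalFrame (A : MiddleFrameField F) (z : OpenPartialHomeomorph M ℂ)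
    (hz : IsSmoothCoordinate z) (hA : z.source ⊆ A.domain)
    (hφ : ∀ q ∈ z.source, ∃ c : ℂ, ∀ X, A.φ q X = c * diff z q X) : ConformalFrame where
  Ω := z.target
  isOpen := z.open_target
  a₀ w := A.a₀ (z.symm w)
  e₁ w := A.a 0 (z.symm w)
  e₂ w := A.a 1 (z.symm w)
  e₃ w := A.a 2 (z.symm w)
  e₄ w := A.a 3 (z.symm w)
  p₁ w := A.p₁ (z.symm w)
  p₂ w := A.p₂ (z.symm w)
  p₃ w := A.p₃ (z.symm w)
  q₁ w := A.q₁ (z.symm w)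
  q₂ w := A.q₂ (z.symm w)
  r w := lor (fderiv ℝ (fun w => A.a₀ (z.symm w)) w 1) (A.a 1 (z.symm w))
  t w := lor (fderiv ℝ (fun w => A.a₀ (z.symm w)) w 1) (A.a 2 (z.symm w))
  smooth_a₀ := hz.contDiffOn_comp_symm A.smooth_a₀ hA
  smooth_e₁ := hz.contDiffOn_comp_symm (A.smooth_a 0) hA
  smooth_e₂ := hz.contDiffOn_comp_symm (A.smooth_a 1) hA
  smooth_e₃ := hz.contDiffOn_comp_symm (A.smooth_a 2) hA
  smooth_e₄ := hz.contDiffOn_comp_symm (A.smooth_a 3) hA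
  smooth_p₁ := hz.contDiffOn_comp_symm A.smooth_p₁ hA
  smooth_p₂ := hz.contDiffOn_comp_symm A.smooth_p₂ hA
  smooth_p₃ := hz.contDiffOn_comp_symm A.smooth_p₃ hA
  smooth_q₁ := hz.contDiffOn_comp_symm A.smooth_q₁ hA
  smooth_q₂ := hz.contDiffOn_comp_symm A.smooth_q₂ hA
  smooth_r := contDiffOn_lor (contDiffOn_fderiv_apply z.open_target
    (hz.contDiffOn_comp_symm A.smooth_a₀ hA) 1) (hz.contDiffOn_comp_symm (A.smooth_a 1) hA)
  smooth_t := contDiffOn_lor (contDiffOn_fderiv_apply z.open_target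
    (hz.contDiffOn_comp_symm A.smooth_a₀ hA) 1) (hz.contDiffOn_comp_symm (A.smooth_a 2) hA)
  isNullBasis w hw := A.isNullBasis (hA (z.map_target hw))
  ne_zero w hw h := by
    have hq := z.map_target hw
    obtain ⟨X, hX, h1⟩ := A.exists_tangent hz hA hφ hw 1
    have h2 : A.φ (z.symm w) X = 0 := by
      rw [h1]
      apply Complex.ext <;> simp <;> nlinarith
    have h3 : X = 0 := A.φLin_injective (hA hq) (by rw [map_zero]; exact h2)
    rw [h3, map_zero] at hX
    exact zero_ne_one hX
  fderiv_a₀ w hw v := by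
    obtain ⟨X, hX, h2, h3⟩ := A.exists_tangent_θ hz hA hφ hw v
    rw [← h2, ← h3, A.fderiv_comp_symm hz hA hw A.smooth_a₀ hX,
      A.diff_a₀ X (hA (z.map_target hw))]
  fderiv_e₁ w hw v := by
    obtain ⟨X, hX, h2, h3⟩ := A.exists_tangent_θ hz hA hφ hw v
    rw [← h2, ← h3, A.fderiv_comp_symm hz hA hw (A.smooth_a 0) hX,
      A.diff_a_zero X (hA (z.map_target hw))]
    rfl
  fderiv_e₂ w hw v := by
    obtain ⟨X, hX, h2, h3⟩ := A.exists_tangent_θ hz hA hφ hw v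
    rw [← h2, ← h3, A.fderiv_comp_symm hz hA hw (A.smooth_a 1) hX,
      A.diff_a_one X (hA (z.map_target hw))]
  fderiv_e₃ w hw v := by
    obtain ⟨X, hX, h2, h3⟩ := A.exists_tangent_θ hz hA hφ hw v
    rw [← h2, ← h3, A.fderiv_comp_symm hz hA hw (A.smooth_a 2) hX,
      A.diff_a_two X (hA (z.map_target hw))]
  fderiv_e₄ w hw v := by
    obtain ⟨X, hX, h2, h3⟩ := A.exists_tangent_θ hz hA hφ hw v
    rw [← h2, ← h3, A.fderiv_comp_symm hz hA hw (A.smooth_a 3) hX,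
      A.diff_a_three X (hA (z.map_target hw))]
    rfl

section

variable (A : MiddleFrameField F) {z : OpenPartialHomeomorph M ℂ} (hz : IsSmoothCoordinate z)
  (hA : z.source ⊆ A.domain)
  (hφ : ∀ q ∈ z.source, ∃ c : ℂ, ∀ X, A.φ q X = c * diff z q X)

lemma φ_eq_μ_mul {q : M} (hq : q ∈ z.source) (X : TangentSpace (𝓡 2) q) :
    A.φ q X = (A.conformalFrame z hz hA hφ).μ (z q) * diff z q X := by
  have key : ∀ w ∈ z.target, ∀ X : TangentSpace (𝓡 2) (z.symm w),
      A.φ (z.symm w) X = (A.conformalFrame z hz hA hφ).μ w * diff z (z.symm w) X := by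
    intro w hw X
    obtain ⟨c, hc⟩ := hφ _ (z.map_target hw)
    obtain ⟨Y, hY, h⟩ := A.exists_tangent hz hA hφ hw 1
    rw [hc, hY, mul_one, mul_one] at h
    rw [hc, h]
    rfl
  have := key (z q) (z.map_source hq)
  rw [z.left_inv hq] at this
  exact this X

lemma s_conformalFrame {q : M} (hq : q ∈ z.source) :
    (A.conformalFrame z hz hA hφ).s (z q) = (A.p₁ q + A.p₃ q) / 2 := by
  simp only [ConformalFrame.s, conformalFrame, z.left_inv hq]

end

end MiddleFrameField

end

/-! ### Holomorphic quartic differential implies L-isothermic and spherical -/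

lemma exists_eq_const_of_locally {N E : Type*} [TopologicalSpace N] [ConnectedSpace N] (f : N → E)
    (h : ∀ p, ∀ᶠ q in 𝓝 p, f q = f p) : ∃ c, ∀ p, f p = c := by
  obtain ⟨p₀⟩ := (inferInstance : Nonempty N)
  exact ⟨f p₀, fun p => (IsLocallyConstant.iff_eventually_eq f).2 h |>.apply_eq_of_preconnectedSpace
    p p₀⟩

section

variable {M : Type*} [TopologicalSpace M] [ChartedSpace (EuclideanSpace ℝ (Fin 2)) M]
variable {F : LegendreImmersion M}

/-- Near every point, the function `s = (p₁ + p₃) / 2` of an immersion with holomorphic quartic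
differential satisfies `ds = -s τ`. -/
lemma LegendreImmersion.HasHolomorphicQuartic.exists_conformalFrame
    (h : F.HasHolomorphicQuartic) (p : M) :
    ∃ (z : OpenPartialHomeomorph M ℂ) (A : MiddleFrameField F) (hz : IsSmoothCoordinate z)
      (hA : z.source ⊆ A.domain)
      (hφ : ∀ q ∈ z.source, ∃ c : ℂ, ∀ X, A.φ q X = c * diff z q X), p ∈ z.source ∧
      ∀ w ∈ z.target, ∀ v, fderiv ℝ (A.conformalFrame z hz hA hφ).s w v =
        -(A.conformalFrame z hz hA hφ).s w * (A.conformalFrame z hz hA hφ).τ w v := by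
  obtain ⟨z₀, ⟨hz₀, hc⟩, hp, g, hg, hQ⟩ := h p
  obtain ⟨A, hpA, hφ₀⟩ := hc p hp
  set z := z₀.restrOpen A.domain A.isOpen_domain
  have hz : IsSmoothCoordinate z := hz₀.restrOpen A.isOpen_domain
  have hA : z.source ⊆ A.domain := fun q hq => hq.2
  have hφ : ∀ q ∈ z.source, ∃ c : ℂ, ∀ X, A.φ q X = c * diff z q X :=
    fun q hq => hφ₀ q ⟨hq.2, hq.1⟩
  refine ⟨z, A, hz, hA, hφ, ⟨hp, hpA⟩, fun w hw v => ?_⟩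
  have htarget : z.target ⊆ z₀.target := fun _ h => h.1
  refine (A.conformalFrame z hz hA hφ).fderiv_s_of_holomorphic (h := g) hw
    (hg.differentiableAt (z₀.open_target.mem_nhds (htarget hw))) (fun x hx => ?_) v
  have hq := z.map_target hx
  obtain ⟨Y, hY⟩ := hz.exists_diff_eq hq 1
  have h1 := hQ _ hq.1 Y
  have h2 : diff z₀ (z.symm x) Y = 1 := hY
  have h3 : z₀ (z.symm x) = x := z.right_inv hx
  rw [A.quarticDifferential_eq (hA hq), A.φ_eq_μ_mul hz hA hφ hq, hY, h2, h3, one_pow, mul_one,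
    mul_one, z.right_inv hx] at h1
  rw [← h1]
  simp only [ConformalFrame.Q, ConformalFrame.d, MiddleFrameField.conformalFrame]
  push_cast
  ring

/-- The function `p₁ + p₃`. -/
def LegendreImmersion.P (F : LegendreImmersion M) (p : M) : ℝ :=
  (F.middleFrameAt p).p₁ p + (F.middleFrameAt p).p₃ p

lemma MiddleFrameField.P_eq (A : MiddleFrameField F) {p : M} (hA : p ∈ A.domain) :
    F.P p = A.p₁ p + A.p₃ p := by
  obtain ⟨-, h1, -, h3⟩ := A.invariants_eq _ hA (A.mem_middleFrameAt hA)
  rw [LegendreImmersion.P, h1, h3]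

/-- The center of the quadric, computed from a middle frame at `p`. -/
def LegendreImmersion.center (F : LegendreImmersion M) (p : M) : Mink :=
  let A := F.middleFrameAt p
  A.a₀ p - (-((A.p₁ p - A.p₃ p) / 2 / ((A.p₁ p + A.p₃ p) / 2))) • A.a 0 p -
    (1 / ((A.p₁ p + A.p₃ p) / 2)) • A.a 3 p

lemma MiddleFrameField.center_eq (A : MiddleFrameField F) {z : OpenPartialHomeomorph M ℂ}
    (hz : IsSmoothCoordinate z) (hA : z.source ⊆ A.domain)
    (hφ : ∀ q ∈ z.source, ∃ c : ℂ, ∀ X, A.φ q X = c * diff z q X) {q : M} (hq : q ∈ z.source) :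
    F.center q = (A.conformalFrame z hz hA hφ).center (z q) := by
  have hqA := hA hq
  have hB := A.mem_middleFrameAt hqA
  obtain ⟨-, h1, -, h3⟩ := A.invariants_eq _ hqA hB
  obtain ⟨h4, h5⟩ := A.a₀_eq_and_a_zero_eq _ hqA hB
  obtain ⟨-, -, -, -, h6⟩ := A.exists_sign _ hqA hB
  simp only [LegendreImmersion.center, h1, h3, h4, h5, h6, ConformalFrame.center,
    ConformalFrame.d, ConformalFrame.s, MiddleFrameField.conformalFrame, z.left_inv hq]

/-- The zero set of `p₁ + p₃` is open and closed, since `d(p₁ + p₃) = -(p₁ + p₃) τ`. -/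
lemma LegendreImmersion.HasHolomorphicQuartic.P_ne_zero [ConnectedSpace M]
    (h : F.HasHolomorphicQuartic)
    (hP : ∃ (p : M) (X : TangentSpace (𝓡 2) p), F.quadraticDifferential p X ≠ 0) (p : M) :
    F.P p ≠ 0 := by
  have hopen : IsOpen {q | F.P q ≠ 0} := by
    rw [isOpen_iff_mem_nhds]
    intro q hq
    obtain ⟨z, A, hz, hA, hφ, hqz, -⟩ := h.exists_conformalFrame q
    have hc : ContinuousAt (fun x => A.p₁ x + A.p₃ x) q :=
      (A.smooth_p₁.contMDiffAt (A.domain_mem_nhds (hA hqz))).continuousAt.add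
        (A.smooth_p₃.contMDiffAt (A.domain_mem_nhds (hA hqz))).continuousAt
    have hq' : A.p₁ q + A.p₃ q ≠ 0 := by rw [← A.P_eq (hA hqz)]; exact hq
    filter_upwards [hc.eventually_ne hq', A.domain_mem_nhds (hA hqz)] with x hx hxA
    have hx' : F.P x ≠ 0 := by rwa [A.P_eq hxA]
    exact hx'
  have hclosed : IsClosed {q | F.P q ≠ 0} := by
    rw [← isOpen_compl_iff, isOpen_iff_mem_nhds]
    intro q hq
    obtain ⟨z, A, hz, hA, hφ, hqz, hs⟩ := h.exists_conformalFrame q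
    have h0 : (A.conformalFrame z hz hA hφ).s (z q) = 0 := by
      rw [A.s_conformalFrame hz hA hφ hqz, ← A.P_eq (hA hqz)]
      simpa using hq
    have h1 := (z.continuousAt hqz).eventually
      ((A.conformalFrame z hz hA hφ).eventually_s_eq_zero hs (z.map_source hqz) h0)
    filter_upwards [h1, z.open_source.mem_nhds hqz] with x hx hxz
    rw [A.s_conformalFrame hz hA hφ hxz, ← A.P_eq (hA hxz)] at hx
    simpa using hx
  obtain ⟨q, X, hX⟩ := hP
  have hq : q ∈ {q | F.P q ≠ 0} := by
    intro h0
    rw [LegendreImmersion.P] at h0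
    apply hX
    rw [LegendreImmersion.quadraticDifferential, h0]
    simp
  have hp : p ∈ {q | F.P q ≠ 0} := by
    rw [IsClopen.eq_univ ⟨hclosed, hopen⟩ ⟨q, hq⟩]
    exact Set.mem_univ p
  exact hp

theorem LegendreImmersion.HasHolomorphicQuartic.isLIsothermic_and_exists_center [ConnectedSpace M]
    (h : F.HasHolomorphicQuartic)
    (hP : ∃ (p : M) (X : TangentSpace (𝓡 2) p), F.quadraticDifferential p X ≠ 0) :
    F.IsLIsothermic ∧ ∃ (O : Mink) (c : ℝ), ∀ p : M,
      lor (F.lGaussMap p - O) (F.lGaussMap p - O) = c := by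
  have hP0 := h.P_ne_zero hP
  have hs0 (z : OpenPartialHomeomorph M ℂ) (A : MiddleFrameField F) (hz : IsSmoothCoordinate z)
      (hA : z.source ⊆ A.domain)
      (hφ : ∀ q ∈ z.source, ∃ c : ℂ, ∀ X, A.φ q X = c * diff z q X) :
      ∀ w ∈ z.target, (A.conformalFrame z hz hA hφ).s w ≠ 0 := by
    intro w hw h0
    have hq := z.map_target hw
    have h1 := A.s_conformalFrame hz hA hφ hq
    rw [z.right_inv hw, h0, ← A.P_eq (hA hq)] at h1
    exact hP0 (z.symm w) (by linarith)
  refine ⟨fun p => ?_, ?_⟩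
  · obtain ⟨z, A, hz, hA, hφ, hpz, hs⟩ := h.exists_conformalFrame p
    set C := A.conformalFrame z hz hA hφ
    have hC0 : ∀ w ∈ C.Ω, C.s w ≠ 0 := hs0 z A hz hA hφ
    obtain ⟨W, hpW, -, hW1, hW2, hW'⟩ := exists_coordinate_of_holomorphic C.isOpen
      (fun w hw => (C.differentiableAt_exp_mul_μ hs hC0 hw).differentiableWithinAt)
      (fun w hw => mul_ne_zero (by exact_mod_cast (Real.exp_pos _).ne') (C.μ_ne_zero hw))
      (z.map_source hpz)
    refine ⟨z ≫ₕ W, hz.trans hW1 hW2, ?_, A, fun q hq => ?_, fun q hq => ?_⟩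
    · rw [OpenPartialHomeomorph.trans_source]
      exact ⟨hpz, hpW⟩
    · rw [OpenPartialHomeomorph.trans_source] at hq
      exact hA hq.1
    rw [OpenPartialHomeomorph.trans_source] at hq
    set ρ := Real.exp (Real.log (C.s (z q)) / 2) with hρ
    have hρ0 : 0 < ρ := Real.exp_pos _
    -- In the new coordinate `w`, `dw = ρ φ` with `ρ` real.
    have hd (X : TangentSpace (𝓡 2) q) : diff (z ≫ₕ W : M → ℂ) q X = ρ * A.φ q X := by
      have h1 := hz.diff_trans hq.1 ((hW' (z q) hq.2).hasFDerivAt.restrictScalars ℝ) X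
      have h2 := A.φ_eq_μ_mul hz hA hφ hq.1 X
      refine h1.trans ?_
      rw [h2, hρ]
      simp only [ContinuousLinearMap.coe_restrictScalars',
        ContinuousLinearMap.toSpanSingleton_apply, smul_eq_mul]
      ring
    have hre (X : TangentSpace (𝓡 2) q) :
        (diff (z ≫ₕ W : M → ℂ) q X).re = ρ * A.θ₂ q X := by
      rw [hd, Complex.re_ofReal_mul, MiddleFrameField.re_φ]
    have him (X : TangentSpace (𝓡 2) q) :
        (diff (z ≫ₕ W : M → ℂ) q X).im = ρ * A.θ₃ q X := by
      rw [hd, Complex.im_ofReal_mul, MiddleFrameField.im_φ]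
    refine ⟨1 / ρ ^ 2, 1 / ρ ^ 2, -(1 / ρ ^ 2), by positivity, fun X => ?_⟩
    rw [A.lor_diff_a₀_self X (hA hq.1), A.lor_diff_a₀_diff_a_zero X (hA hq.1), hre, him]
    constructor <;> field_simp
    ring
  · obtain ⟨O, hO⟩ := exists_eq_const_of_locally F.center fun p => by
      obtain ⟨z, A, hz, hA, hφ, hpz, hs⟩ := h.exists_conformalFrame p
      set C := A.conformalFrame z hz hA hφ
      have hC0 : ∀ w ∈ C.Ω, C.s w ≠ 0 := hs0 z A hz hA hφ
      have h1 := (z.continuousAt hpz).eventually (eventually_eq_of_fderiv_eq_zero C.isOpen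
        (fun w hw => (C.differentiableAt_center hC0 hw).differentiableWithinAt)
        (fun w hw v => C.fderiv_center_eq_zero hs hC0 hw v) (z.map_source hpz))
      filter_upwards [h1, z.open_source.mem_nhds hpz] with q hq hqz
      rw [A.center_eq hz hA hφ hqz, A.center_eq hz hA hφ hpz]
      exact hq
    obtain ⟨c, hc⟩ := exists_eq_const_of_locally
      (fun p => lor (F.lGaussMap p - F.center p) (F.lGaussMap p - F.center p)) fun p => by
      obtain ⟨z, A, hz, hA, hφ, hpz, hs⟩ := h.exists_conformalFrame p
      set C := A.conformalFrame z hz hA hφ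
      have hC0 : ∀ w ∈ C.Ω, C.s w ≠ 0 := hs0 z A hz hA hφ
      have hdiff (w : ℂ) (hw : w ∈ C.Ω) : DifferentiableAt ℝ (fun w => C.a₀ w - C.center w) w :=
        (C.diffAt C.smooth_a₀ hw).fun_sub (C.differentiableAt_center hC0 hw)
      have h1 := (z.continuousAt hpz).eventually (eventually_eq_of_fderiv_eq_zero C.isOpen
        (fun w hw => (differentiableAt_lor (hdiff w hw) (hdiff w hw)).differentiableWithinAt)
        (fun w hw v => C.fderiv_lor_sub_center hs hC0 hw v) (z.map_source hpz))
      have ha₀ (q : M) (hq : q ∈ z.source) : F.lGaussMap q = C.a₀ (z q) := by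
        rw [A.lGaussMap_eq (hA hq)]
        simp only [C, MiddleFrameField.conformalFrame, z.left_inv hq]
      filter_upwards [h1, z.open_source.mem_nhds hpz] with q hq hqz
      rw [A.center_eq hz hA hφ hqz, A.center_eq hz hA hφ hpz, ha₀ q hqz, ha₀ p hpz]
      exact hq
    exact ⟨O, c, fun p => by rw [← hc p, hO p]⟩

/-! ### L-isothermic and spherical implies holomorphic quartic differential -/

/-- Near every point of an L-isothermic immersion there is a coordinate in which `φ` is a real
multiple of `dz`. It is the given isothermic coordinate, followed by the linear map that turns
`dz` into `φ` at the point; this settles the orientation, and the roles of `x` and `y`. -/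
lemma LegendreImmersion.IsLIsothermic.exists_real_factor (h : F.IsLIsothermic) (p : M) :
    ∃ (z : OpenPartialHomeomorph M ℂ) (A : MiddleFrameField F), IsSmoothCoordinate z ∧
      z.source ⊆ A.domain ∧ p ∈ z.source ∧
      ∀ q ∈ z.source, ∃ k : ℝ, ∀ X, A.φ q X = k * diff z q X := by
  obtain ⟨z, hz, hpz, A, hA, hE⟩ := h p
  -- the components of `α²` (`i = 1`) and of `α³` (`i = 2`) in the coordinate `z`
  set f : Fin 4 → ℂ → M → ℝ := fun i v q =>
    lor (fderiv ℝ (fun w => A.a₀ (z.symm w)) (z q) v) (A.a i (z.symm (z q))) with hf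
  have ha₀ := hz.contDiffOn_comp_symm A.smooth_a₀ hA
  have hfc (i : Fin 4) (v : ℂ) : ContinuousAt (f i v) p := by
    have h1 := MiddleFrameField.contDiffOn_lor (contDiffOn_fderiv_apply z.open_target ha₀ v)
      (hz.contDiffOn_comp_symm (A.smooth_a i) hA)
    exact ContinuousAt.comp (g := fun w => lor (fderiv ℝ (fun w => A.a₀ (z.symm w)) w v)
      (A.a i (z.symm w))) (h1.contDiffAt (z.open_target.mem_nhds (z.map_source hpz))).continuousAt
      (z.continuousAt hpz)
  have hlin (i : Fin 4) {q : M} (hq : q ∈ z.source) (X : TangentSpace (𝓡 2) q) :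
      lor (diff A.a₀ q X) (A.a i q) =
        f i 1 q * (diff z q X).re + f i Complex.I q * (diff z q X).im := by
    rw [← hz.fderiv_comp_symm hq
      (differentiableAt_of_smoothOn z.open_target ha₀ (z.map_source hq)),
      fderiv_apply_eq_re_im, lor_add_left, lor_smul_left, lor_smul_left, hf]
    simp only [z.left_inv hq]
    ring
  have hθ₂ {q : M} (hq : q ∈ z.source) (X : TangentSpace (𝓡 2) q) :
      A.θ₂ q X = f 1 1 q * (diff z q X).re + f 1 Complex.I q * (diff z q X).im := by
    rw [← hlin 1 hq, A.lor_diff_a₀_one X (hA hq)]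
  have hθ₃ {q : M} (hq : q ∈ z.source) (X : TangentSpace (𝓡 2) q) :
      A.θ₃ q X = f 2 1 q * (diff z q X).re + f 2 Complex.I q * (diff z q X).im := by
    rw [← hlin 2 hq, A.lor_diff_a₀_two X (hA hq)]
  have hfac := eventually_exists_factor (hfc 1 1) (hfc 1 Complex.I) (hfc 2 1) (hfc 2 Complex.I) (by
    filter_upwards [z.open_source.mem_nhds hpz] with q hq
    obtain ⟨E, a, b, hE0, hX⟩ := hE q hq
    refine ⟨E, a, b, hE0, fun x y => ?_⟩
    obtain ⟨X, hXv⟩ := hz.exists_diff_eq hq ⟨x, y⟩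
    have h1 := hX X
    rw [A.lor_diff_a₀_self X (hA hq), A.lor_diff_a₀_diff_a_zero X (hA hq), hθ₂ hq, hθ₃ hq, hXv]
      at h1
    exact h1)
  obtain ⟨U, hU, hUo, hpU⟩ := mem_nhds_iff.1 hfac
  let L : ℂ →ₗ[ℝ] ℂ :=
    { toFun := fun v => ⟨f 1 1 p * v.re + f 1 Complex.I p * v.im,
        f 2 1 p * v.re + f 2 Complex.I p * v.im⟩
      map_add' := fun v w => by
        apply Complex.ext <;> simp <;> ring
      map_smul' := fun c v => by
        apply Complex.ext <;> simp <;> ring }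
  have hLφ (X : TangentSpace (𝓡 2) p) : L (diff z p X) = A.φ p X := by
    apply Complex.ext
    · rw [MiddleFrameField.re_φ, hθ₂ hpz]
      rfl
    · rw [MiddleFrameField.im_φ, hθ₃ hpz]
      rfl
  have hL : Function.Injective L := by
    rw [injective_iff_map_eq_zero]
    intro v hv
    obtain ⟨X, rfl⟩ := hz.exists_diff_eq hpz v
    rw [hLφ] at hv
    have hX : X = 0 := A.φLin_injective (hA hpz) (by rw [map_zero]; exact hv)
    rw [hX, map_zero]
  let T : ℂ ≃L[ℝ] ℂ := (LinearEquiv.ofInjectiveEndo L hL).toContinuousLinearEquiv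
  have hT (v : ℂ) : T v = L v := rfl
  set z₁ := z.restrOpen U hUo
  have hz₁ : IsSmoothCoordinate z₁ := hz.restrOpen hUo
  refine ⟨z₁ ≫ₕ T.toHomeomorph.toOpenPartialHomeomorph, A,
    hz₁.trans T.contDiff.contDiffOn T.symm.contDiff.contDiffOn, fun q hq => ?_, ?_,
    fun q hq => ?_⟩
  · rw [OpenPartialHomeomorph.trans_source] at hq
    exact hA hq.1.1
  · rw [OpenPartialHomeomorph.trans_source]
    exact ⟨⟨hpz, hpU⟩, trivial⟩
  · rw [OpenPartialHomeomorph.trans_source] at hq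
    obtain ⟨k, k1, k2, k3, k4⟩ := hU hq.1.2
    refine ⟨k, fun X => ?_⟩
    have h1 : diff (z₁ ≫ₕ T.toHomeomorph.toOpenPartialHomeomorph : M → ℂ) q X =
      L (diff z q X) := hz₁.diff_trans hq.1 T.hasFDerivAt X
    rw [h1]
    apply Complex.ext
    · rw [MiddleFrameField.re_φ, hθ₂ hq.1.1, k1, k2, Complex.re_ofReal_mul]
      simp only [L, LinearMap.coe_mk, AddHom.coe_mk]
      ring
    · rw [MiddleFrameField.im_φ, hθ₃ hq.1.1, k3, k4, Complex.im_ofReal_mul]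
      simp only [L, LinearMap.coe_mk, AddHom.coe_mk]
      ring

theorem LegendreImmersion.IsLIsothermic.hasHolomorphicQuartic_and_ne_zero [Nonempty M]
    (h : F.IsLIsothermic) {O : Mink} {c : ℝ}
    (hc : ∀ p : M, lor (F.lGaussMap p - O) (F.lGaussMap p - O) = c) :
    F.HasHolomorphicQuartic ∧
      ∃ (p : M) (X : TangentSpace (𝓡 2) p), F.quadraticDifferential p X ≠ 0 := by
  have key (p : M) : ∃ (z : OpenPartialHomeomorph M ℂ) (A : MiddleFrameField F)
      (hz : IsSmoothCoordinate z) (hA : z.source ⊆ A.domain)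
      (hφ : ∀ q ∈ z.source, ∃ c : ℂ, ∀ X, A.φ q X = c * diff z q X), p ∈ z.source ∧
      (∀ w ∈ z.target, (A.conformalFrame z hz hA hφ).t w = 0) ∧
      ∀ w ∈ z.target, lor ((A.conformalFrame z hz hA hφ).a₀ w - O)
        ((A.conformalFrame z hz hA hφ).a₀ w - O) = c := by
    obtain ⟨z, A, hz, hA, hpz, hk⟩ := h.exists_real_factor p
    have hφ : ∀ q ∈ z.source, ∃ c : ℂ, ∀ X, A.φ q X = c * diff z q X := fun q hq => by
      obtain ⟨k, hk⟩ := hk q hq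
      exact ⟨k, hk⟩
    refine ⟨z, A, hz, hA, hφ, hpz, fun w hw => ?_, fun w hw => ?_⟩
    · have hq := z.map_target hw
      obtain ⟨k, hk⟩ := hk _ hq
      obtain ⟨X, hX⟩ := hz.exists_diff_eq hq 1
      have h1 := A.φ_eq_μ_mul hz hA hφ hq X
      rw [hk, hX, mul_one, mul_one, z.right_inv hw] at h1
      simpa [ConformalFrame.μ] using (congrArg Complex.im h1).symm
    · rw [← hc (z.symm w), A.lGaussMap_eq (hA (z.map_target hw))]
      rfl
  refine ⟨fun p => ?_, ?_⟩
  · obtain ⟨z, A, hz, hA, hφ, hpz, ht, hO⟩ := key p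
    set C := A.conformalFrame z hz hA hφ
    obtain ⟨hp₂, -, hd⟩ := C.quartic_of_lor_sub_eq_const hO ht
    have hdiff : DifferentiableOn ℝ (fun w => C.d w * C.r w ^ 4) C.Ω := fun w hw =>
      ((C.diffAt C.smooth_d hw).fun_mul ((C.diffAt C.smooth_r hw).fun_pow 4)).differentiableWithinAt
    have hloc := (z.continuousAt hpz).eventually
      (eventually_eq_of_fderiv_eq_zero C.isOpen hdiff hd (z.map_source hpz))
    obtain ⟨U, hU, hUo, hpU⟩ := mem_nhds_iff.1 hloc
    refine ⟨z.restrOpen U hUo, ⟨hz.restrOpen hUo, fun q hq => ⟨A, hA hq.1, fun q' hq' =>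
      hφ q' hq'.2.1⟩⟩, ⟨hpz, hpU⟩, fun _ => ((C.d (z p) * C.r (z p) ^ 4 : ℝ) : ℂ),
      differentiableOn_const _, fun q hq X => ?_⟩
    have h1 : C.d (z q) * C.r (z q) ^ 4 = C.d (z p) * C.r (z p) ^ 4 := hU hq.2
    have h2 : A.p₂ q = 0 := by
      rw [← z.left_inv hq.1]; exact hp₂ _ (z.map_source hq.1)
    have h3 : (A.p₁ q - A.p₃ q) / 2 = C.d (z q) := by
      simp only [C, ConformalFrame.d, MiddleFrameField.conformalFrame, z.left_inv hq.1]
    have h4 : diff (z.restrOpen U hUo : M → ℂ) q X = diff z q X := rfl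
    rw [A.quarticDifferential_eq (hA hq.1), A.φ_eq_μ_mul hz hA hφ hq.1, h2, h3, h4, ← h1]
    simp only [ConformalFrame.μ]
    rw [ht _ (z.map_source hq.1)]
    push_cast
    ring
  · obtain ⟨p⟩ := (inferInstance : Nonempty M)
    obtain ⟨z, A, hz, hA, hφ, hpz, ht, hO⟩ := key p
    obtain ⟨-, hs, -⟩ := (A.conformalFrame z hz hA hφ).quartic_of_lor_sub_eq_const hO ht
    have hsp := hs _ (z.map_source hpz)
    rw [A.s_conformalFrame hz hA hφ hpz] at hsp
    obtain ⟨X, hX⟩ := A.exists_φ_eq (hA hpz) 1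
    refine ⟨p, X, ?_⟩
    rw [A.quadraticDifferential_eq (hA hpz), hX, one_pow, mul_one]
    intro h0
    apply hsp
    rw [Complex.ofReal_eq_zero.1 h0, zero_div]

end

end Laguerre

end

theorem proposition4p4 {M : Type*} [TopologicalSpace M]
    [ChartedSpace (EuclideanSpace ℝ (Fin 2)) M] [IsManifold (𝓡 2) ∞ M] [ConnectedSpace M]
    (F : Laguerre.LegendreImmersion M) (hF : F.IsNondegenerate) :
    (F.HasHolomorphicQuartic ∧
        ∃ (p : M) (X : TangentSpace (𝓡 2) p), F.quadraticDifferential p X ≠ 0) ↔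
      (F.IsLIsothermic ∧
        ∃ (O : Laguerre.Mink) (c : ℝ), ∀ p : M,
          Laguerre.lor (F.lGaussMap p - O) (F.lGaussMap p - O) = c) :=
  ⟨fun h => h.1.isLIsothermic_and_exists_center h.2,
    fun ⟨h, _, _, hc⟩ => h.hasHolomorphicQuartic_and_ne_zero hc⟩
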